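/- Let $M,N\ge 0$ be integers, $a,b\in\mathbb{C}\setminus\{0\}$, $w_1,\dots,w_M\in\mathbb{C}$, and $z_1,\dots,z_N\in\mathbb{C}\setminus\{0\}$ with $z_j^4\ne1$ for all $j$ and $z_j^2\neq z_k^2$, $z_j^2z_k^2\ne1$ for all $j\ne k$. \textbf{The model.} Let $V_a$ (auxiliary) and $\mathcal F_1,\dots,\mathcal F_M$ be copies of $\mathbb{C}^2$ with basis $|0\rangle,|1\rangle$. Let $L_{aj}(z,w)$ act on $V_a\otimes\mathcal F_j$, with nonzero matrix elements (the first label being that of $V_a$) $$\langle 00|L|00\rangle=\langle 11|L|11\rangle=az^{-1}w-a^{-1}z,\qquad \langle 01|L|01\rangle=\langle 10|L|10\rangle=az-a^{-1}z^{-1}w,$$ $$\langle 01|L|10\rangle=a^2-a^{-2},\qquad \langle 10|L|01\rangle=(a^2-a^{-2})w .$$ Put $T_a(z)=L_{a1}(z,w_1)\cdots L_{aM}(z,w_M)$, let $$K_{a_2a_1}(z)={}_{a_2}\langle0|\,{}_{a_1}\langle1|\,(baz-b^{-1}a^{-1}z^{-1})+{}_{a_2}\langle1|\,{}_{a_1}\langle0|\,(ba^{-1}z^{-1}-b^{-1}az),$$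 and let $$\mathcal B(z)=K_{a_2a_1}(z)\,T_{a_2}(z^{-1})\,T_{a_1}(z)\,|1\rangle_{a_2}|1\rangle_{a_1},$$ an operator on $\mathcal F_1\otimes\cdots\otimes\mathcal F_M$. For $1\le x_1<\dots<x_N\le M$ let $\langle x_1\cdots x_N|$ be the dual basis vector with label $1$ at the sites $x_1,\dots,x_N$ and $0$ at the others. For $1\le\overline{x_1}<\dots<\overline{x_N}\le M$ let $|\overline{x_1}\cdots\overline{x_N}\rangle$ be the basis vector with label $0$ at the sites $\overline{x_1},\dots,\overline{x_N}$ and $1$ at the others. Let $|0^M\rangle$ be the basis vector with all labels $0$, and $\langle1^M|$ the dual basis vector with all labels $1$. The wavefunction and the dual wavefunction are $$W_{M,N}(z|w|x)=\langle x_1\cdots x_N|\mathcal B(z_1)\cdots\mathcal B(z_N)|0^M\rangle,\qquad \overline W_{M,N}(z|w|\overline x)=\langle1^M|\mathcal B(z_1)\cdots\mathcal B(z_N)|\overline{x_1}\cdots\overline{x_N}\rangle .$$ \textbf{The functions.} For $\sigma\in S_N$ and $\tau\in\{\pm1\}^N$ put $u_k=z_{\sigma(k)}^{\tau_{\sigma(k)}}$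 and $$P_{\sigma,\tau}=\prod_{j=1}^N\frac1{z_j^{2\tau_j}-z_j^{-2\tau_j}}\prod_{1\le j<k\le N}\frac{(a^2u_ju_k-a^{-2}u_j^{-1}u_k^{-1})(a^2u_j^{-1}u_k-a^{-2}u_ju_k^{-1})}{(u_ju_k-u_j^{-1}u_k^{-1})(u_j^{-1}u_k-u_ju_k^{-1})},$$ and let $C=(a^2-a^{-2})^N\prod_{j=1}^N(-a^2z_j^2+a^{-2}z_j^{-2})$. Define $$F_{M,N}(z|w|x)=C\sum_{\sigma\in S_N}\sum_{\tau\in\{\pm1\}^N}P_{\sigma,\tau}\prod_{k=1}^N\Bigl[(ba^{-1}u_k^{-1}-b^{-1}au_k)\prod_{j=1}^M(au_k^{-1}-a^{-1}u_kw_j)\prod_{j=1}^{x_k-1}(au_k^{-1}w_j-a^{-1}u_k)\prod_{j=x_k+1}^M(au_k-a^{-1}u_k^{-1}w_j)\Bigr],$$ $$\overline F_{M,N}(z|w|\overline x)=C\sum_{\sigma\in S_N}\sum_{\tau\in\{\pm1\}^N}P_{\sigma,\tau}\prod_{k=1}^N\Bigl[(bau_k-b^{-1}a^{-1}u_k^{-1})\prod_{j=1}^M(au_k^{-1}w_j-a^{-1}u_k)\prod_{j=1}^{\overline{x_k}-1}(au_k^{-1}-a^{-1}u_kw_j)\prod_{j=\overline{x_k}+1}^M(au_kw_j-a^{-1}u_k^{-1})\Bigr].$$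 \textbf{Theorem.} The functions $F_{M,N}$ and $\overline F_{M,N}$ are symmetric in $z_1,\dots,z_N$. For all $1\le x_1<\dots<x_N\le M$, $$W_{M,N}(z_1,\dots,z_N|w_1,\dots,w_M|x_1,\dots,x_N)=F_{M,N}(z_1,\dots,z_N|w_1,\dots,w_M|x_1,\dots,x_N),$$ and for all $1\le\overline{x_1}<\dots<\overline{x_N}\le M$, $$\overline W_{M,N}(z_1,\dots,z_N|w_1,\dots,w_M|\overline{x_1},\dots,\overline{x_N})=\overline F_{M,N}(z_1,\dots,z_N|w_1,\dots,w_M|\overline{x_1},\dots,\overline{x_N}).$$ -/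

import Mathlib

open scoped BigOperators

namespace SixVertexReflecting

/-- Labels of the standard basis of `𝓕₁ ⊗ ⋯ ⊗ 𝓕_M`, each `𝓕_j = ℂ²` having basis `|0⟩, |1⟩`.
Sites are numbered from `0`. Operators are written as matrices in the standard bases, with
`A out inp = ⟨out| A |inp⟩`, so that matrix multiplication is composition. -/
abbrev Config (M : ℕ) : Type := Fin M → Fin 2

/-- The `L`-operator (the `U_q(sl₂)` `R`-matrix) on `V_a ⊗ 𝓕_j`:
`lMatrix a z w (γ, δ) (α, β) = ⟨γ|_a ⟨δ|_j L_{aj}(z, w) |α⟩_a |β⟩_j`. -/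
noncomputable def lMatrix (a z w : ℂ) : Matrix (Fin 2 × Fin 2) (Fin 2 × Fin 2) ℂ :=
  fun out inp => match out, inp with
    | (0, 0), (0, 0) => a * z⁻¹ * w - a⁻¹ * z
    | (0, 1), (0, 1) => a * z - a⁻¹ * z⁻¹ * w
    | (0, 1), (1, 0) => a ^ 2 - (a ^ 2)⁻¹
    | (1, 0), (0, 1) => (a ^ 2 - (a ^ 2)⁻¹) * w
    | (1, 0), (1, 0) => a * z - a⁻¹ * z⁻¹ * w
    | (1, 1), (1, 1) => a * z⁻¹ * w - a⁻¹ * z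
    | _, _ => 0

/-- `L_{aj}(z, w)` as an operator on `V_a ⊗ 𝓕₁ ⊗ ⋯ ⊗ 𝓕_M`: it acts as `lMatrix` on `V_a ⊗ 𝓕_j`
and as the identity on the other factors. -/
noncomputable def lOperator (a z w : ℂ) {M : ℕ} (j : Fin M) :
    Matrix (Fin 2 × Config M) (Fin 2 × Config M) ℂ :=
  fun out inp =>
    if ∀ k, k ≠ j → out.2 k = inp.2 k then
      lMatrix a z w (out.1, out.2 j) (inp.1, inp.2 j)
    else 0

/-- The monodromy matrix `T_a(z | w) = L_{a1}(z, w₁) ⋯ L_{aM}(z, w_M)`. -/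
noncomputable def monodromy (a z : ℂ) {M : ℕ} (w : Fin M → ℂ) :
    Matrix (Fin 2 × Config M) (Fin 2 × Config M) ℂ :=
  (List.ofFn fun j : Fin M => lOperator a z (w j) j).prod

/-- An operator on `V_{a₂} ⊗ 𝓕₁ ⊗ ⋯ ⊗ 𝓕_M` extended by the identity of `V_{a₁}` to
`(V_{a₂} ⊗ V_{a₁}) ⊗ 𝓕₁ ⊗ ⋯ ⊗ 𝓕_M`. -/
def onSecondAux {M : ℕ} (T : Matrix (Fin 2 × Config M) (Fin 2 × Config M) ℂ) :
    Matrix ((Fin 2 × Fin 2) × Config M) ((Fin 2 × Fin 2) × Config M) ℂ :=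
  fun out inp => if out.1.2 = inp.1.2 then T (out.1.1, out.2) (inp.1.1, inp.2) else 0

/-- An operator on `V_{a₁} ⊗ 𝓕₁ ⊗ ⋯ ⊗ 𝓕_M` extended by the identity of `V_{a₂}` to
`(V_{a₂} ⊗ V_{a₁}) ⊗ 𝓕₁ ⊗ ⋯ ⊗ 𝓕_M`. -/
def onFirstAux {M : ℕ} (T : Matrix (Fin 2 × Config M) (Fin 2 × Config M) ℂ) :
    Matrix ((Fin 2 × Fin 2) × Config M) ((Fin 2 × Fin 2) × Config M) ℂ :=
  fun out inp => if out.1.1 = inp.1.1 then T (out.1.2, out.2) (inp.1.2, inp.2) else 0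

/-- The coefficients of the covector
`K_{a₂a₁}(z) = ⟨0|_{a₂}⟨1|_{a₁} (b a z - b⁻¹ a⁻¹ z⁻¹) + ⟨1|_{a₂}⟨0|_{a₁} (b a⁻¹ z⁻¹ - b⁻¹ a z)`;
the argument is the pair of labels for `(a₂, a₁)`. -/
noncomputable def kCovector (a b z : ℂ) : Fin 2 × Fin 2 → ℂ
  | (0, 1) => b * a * z - b⁻¹ * a⁻¹ * z⁻¹
  | (1, 0) => b * a⁻¹ * z⁻¹ - b⁻¹ * a * z
  | _ => 0

/-- `K_{a₂a₁}(z)` as an operator from `(V_{a₂} ⊗ V_{a₁}) ⊗ 𝓕₁ ⊗ ⋯ ⊗ 𝓕_M` to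
`𝓕₁ ⊗ ⋯ ⊗ 𝓕_M`. -/
noncomputable def kOperator (a b z : ℂ) (M : ℕ) :
    Matrix (Config M) ((Fin 2 × Fin 2) × Config M) ℂ :=
  fun out inp => if out = inp.2 then kCovector a b z inp.1 else 0

/-- The double-row monodromy matrix
`𝒯_{a₂a₁}(z | w) = K_{a₂a₁}(z) T_{a₂}(z⁻¹ | w) T_{a₁}(z | w)`. -/
noncomputable def doubleRowMonodromy (a b z : ℂ) {M : ℕ} (w : Fin M → ℂ) :
    Matrix (Config M) ((Fin 2 × Fin 2) × Config M) ℂ :=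
  kOperator a b z M * onSecondAux (monodromy a z⁻¹ w) * onFirstAux (monodromy a z w)

/-- The double-row `B`-operator `ℬ(z | w) = 𝒯_{a₂a₁}(z | w) |1⟩_{a₂} |1⟩_{a₁}`, an operator on
`𝓕₁ ⊗ ⋯ ⊗ 𝓕_M`. -/
noncomputable def doubleRowB (a b z : ℂ) {M : ℕ} (w : Fin M → ℂ) :
    Matrix (Config M) (Config M) ℂ :=
  fun out inp => doubleRowMonodromy a b z w out ((1, 1), inp)

/-- The label of the state `⟨x₁ ⋯ x_N|`: the sites `x₁, …, x_N` carry `1`, all others `0`. -/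
def particles {M N : ℕ} (x : Fin N → Fin M) : Config M :=
  fun j => if ∃ k, x k = j then 1 else 0

/-- The label of the state `|x̄₁ ⋯ x̄_N⟩` obtained from `|1^M⟩`: the sites `x̄₁, …, x̄_N` carry `0`,
all others `1`. -/
def holes {M N : ℕ} (x : Fin N → Fin M) : Config M :=
  fun j => if ∃ k, x k = j then 0 else 1

/-- The wavefunction
`W_{M,N}(z | w | x) = ⟨x₁ ⋯ x_N| ℬ(z₁ | w) ⋯ ℬ(z_N | w) |0^M⟩`. -/
noncomputable def wavefunction (a b : ℂ) {M N : ℕ} (z : Fin N → ℂ) (w : Fin M → ℂ)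
    (x : Fin N → Fin M) : ℂ :=
  (List.ofFn fun j : Fin N => doubleRowB a b (z j) w).prod (particles x) (fun _ => 0)

/-- The dual wavefunction
`W̄_{M,N}(z | w | x̄) = ⟨1^M| ℬ(z₁ | w) ⋯ ℬ(z_N | w) |x̄₁ ⋯ x̄_N⟩`. -/
noncomputable def dualWavefunction (a b : ℂ) {M N : ℕ} (z : Fin N → ℂ) (w : Fin M → ℂ)
    (x : Fin N → Fin M) : ℂ :=
  (List.ofFn fun j : Fin N => doubleRowB a b (z j) w).prod (fun _ => 1) (holes x)

/-- The factor
`∏_{j<k} (a²u_j u_k - a⁻²u_j⁻¹u_k⁻¹)(a²u_j⁻¹u_k - a⁻²u_j u_k⁻¹) /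
  ((u_j u_k - u_j⁻¹u_k⁻¹)(u_j⁻¹u_k - u_j u_k⁻¹))`. -/
noncomputable def pairFactor (a : ℂ) {N : ℕ} (u : Fin N → ℂ) : ℂ :=
  ∏ j : Fin N, ∏ k ∈ Finset.Ioi j,
    ((a ^ 2 * u j * u k - (a ^ 2)⁻¹ * (u j)⁻¹ * (u k)⁻¹) *
        (a ^ 2 * (u j)⁻¹ * u k - (a ^ 2)⁻¹ * u j * (u k)⁻¹)) /
      ((u j * u k - (u j)⁻¹ * (u k)⁻¹) * ((u j)⁻¹ * u k - u j * (u k)⁻¹))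

/-- The symmetric function `F_{M,N}(z | w | x)`. In each summand `u k` is
`z_{σ(k)} ^ τ_{σ(k)}`; the signs `τ_j = ±1` are the units of `ℤ`. -/
noncomputable def symF (a b : ℂ) {M N : ℕ} (z : Fin N → ℂ) (w : Fin M → ℂ)
    (x : Fin N → Fin M) : ℂ :=
  (a ^ 2 - (a ^ 2)⁻¹) ^ N * (∏ j, (-(a ^ 2) * z j ^ 2 + (a ^ 2)⁻¹ * (z j ^ 2)⁻¹)) *
    ∑ σ : Equiv.Perm (Fin N), ∑ τ : Fin N → ℤˣ,
      let u : Fin N → ℂ := fun k => z (σ k) ^ (τ (σ k) : ℤ)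
      (∏ j, 1 / (z j ^ (2 * (τ j : ℤ)) - z j ^ (-2 * (τ j : ℤ)))) *
        pairFactor a u *
        (∏ k, (b * a⁻¹ * (u k)⁻¹ - b⁻¹ * a * u k)) *
        (∏ k, ∏ j, (a * (u k)⁻¹ - a⁻¹ * u k * w j)) *
        (∏ k, ∏ j ∈ Finset.Iio (x k), (a * (u k)⁻¹ * w j - a⁻¹ * u k)) *
        (∏ k, ∏ j ∈ Finset.Ioi (x k), (a * u k - a⁻¹ * (u k)⁻¹ * w j))

/-- The symmetric function `F̄_{M,N}(z | w | x̄)`, with the same conventions as for `symF`. -/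
noncomputable def dualSymF (a b : ℂ) {M N : ℕ} (z : Fin N → ℂ) (w : Fin M → ℂ)
    (x : Fin N → Fin M) : ℂ :=
  (a ^ 2 - (a ^ 2)⁻¹) ^ N * (∏ j, (-(a ^ 2) * z j ^ 2 + (a ^ 2)⁻¹ * (z j ^ 2)⁻¹)) *
    ∑ σ : Equiv.Perm (Fin N), ∑ τ : Fin N → ℤˣ,
      let u : Fin N → ℂ := fun k => z (σ k) ^ (τ (σ k) : ℤ)
      (∏ j, 1 / (z j ^ (2 * (τ j : ℤ)) - z j ^ (-2 * (τ j : ℤ)))) *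
        pairFactor a u *
        (∏ k, (b * a * u k - b⁻¹ * a⁻¹ * (u k)⁻¹)) *
        (∏ k, ∏ j, (a * (u k)⁻¹ * w j - a⁻¹ * u k)) *
        (∏ k, ∏ j ∈ Finset.Iio (x k), (a * (u k)⁻¹ - a⁻¹ * u k * w j)) *
        (∏ k, ∏ j ∈ Finset.Ioi (x k), (a * u k * w j - a⁻¹ * (u k)⁻¹))

end SixVertexReflecting

/-! The proof is an algebraic Bethe ansatz. Let B and D be the entries ⟨0|T|1⟩ and ⟨1|T|1⟩ of the
single-row monodromy matrix. Removing the first site gives, by induction on M, their exchange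
relations (`rowOp_exchange`): the B's commute, the D's commute, and D(v)B(u) is a combination of
B(u)D(v) and B(v)D(u), with coefficients `exchF` and `exchG`.

Consequently ℬ(z) is a combination of B(z)D(z⁻¹) and B(z⁻¹)D(z) (`doubleRowOp_apply`). In a product
of ℬ's every D is moved to the right, onto the vacuum, its eigenvector. The terms containing an
`exchG` cancel after summation over signs (`unwanted_terms_cancel`), which leaves a sum over τ of
explicit multiples of ∏ B(z_j^{τ_j})|0^M⟩ (`doubleRowOp_prod_vacuum`). The components of such a
vector are sums over S_N, found again by induction on the number of sites (`prod_B_vacuum_apply`).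
The pair factors of the two sums multiply to `pairFactor`.

For the dual wavefunction, the column weights are given two parameters p, q, with (1, w) the
original model. Transposing and exchanging the labels 0 and 1 turns (1, w) into (w, 1) and b into
-b⁻¹, and reverses the product of the ℬ's. The symmetry of the sum, a mere reindexing, absorbs the
reversal, so both formulas are instances of one identity for `homF`. -/

namespace SixVertexReflecting

/-! ### Exchange coefficients and vertex weights. -/

/-- The coefficient of `B(u) D(v)` in `D(v) B(u)`. -/
noncomputable def exchF (a v u : ℂ) : ℂ :=
  -((a ^ 2 * u ^ 2 - (a ^ 2)⁻¹ * v ^ 2) / (u ^ 2 - v ^ 2))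

/-- The coefficient of `B(v) D(u)` in `D(v) B(u)`. -/
noncomputable def exchG (a v u : ℂ) : ℂ :=
  (a ^ 2 - (a ^ 2)⁻¹) * (u * v) / (u ^ 2 - v ^ 2)

/-- The weight of a vertex with equal labels, for the homogeneous column parameters `p, q`. -/
noncomputable def equalWeight (a p q z : ℂ) : ℂ := a * z⁻¹ * q - a⁻¹ * z * p

/-- The weight of a vertex with distinct labels that are preserved. -/
noncomputable def distinctWeight (a p q z : ℂ) : ℂ := a * z * p - a⁻¹ * z⁻¹ * q

/-- In D(v)B(u)B(t), the operator D(t) arises in two ways: D(v) passes u and swaps with t, or swaps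
with u and then with t. This merges the two coefficients into one product. -/
theorem exchF_add_exchG_chain {a v u t : ℂ} (ha : a ≠ 0)
    (hvu : v ^ 2 ≠ u ^ 2) (hvt : v ^ 2 ≠ t ^ 2) (hut : u ^ 2 ≠ t ^ 2) :
    exchF a v u * exchG a v t + exchG a v u * exchG a u t = exchG a v t * exchF a t u := by
  have h1 : u ^ 2 - v ^ 2 ≠ 0 := sub_ne_zero.2 hvu.symm
  have h2 : t ^ 2 - v ^ 2 ≠ 0 := sub_ne_zero.2 hvt.symm
  have h3 : t ^ 2 - u ^ 2 ≠ 0 := sub_ne_zero.2 hut.symm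
  unfold exchF exchG
  rw [show u ^ 2 - t ^ 2 = -(t ^ 2 - u ^ 2) by ring]
  field_simp
  ring

/-- Merges the two contributions to a particle on the first site in `slice_one_prod_B`: either it
was there before B(u) acts, or B(u) creates it and D(u) swaps its argument with v. -/
theorem equalWeight_exchange {a p q u v : ℂ} (ha : a ≠ 0) (hu : u ≠ 0) (hv : v ≠ 0)
    (huv : u ^ 2 ≠ v ^ 2) :
    distinctWeight a p q u + equalWeight a p q v * exchG a u v
      = exchF a v u * equalWeight a p q u := by
  have h1 : u ^ 2 - v ^ 2 ≠ 0 := sub_ne_zero.2 huv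
  unfold exchF exchG equalWeight distinctWeight
  rw [show v ^ 2 - u ^ 2 = -(u ^ 2 - v ^ 2) by ring]
  field_simp
  ring

/-! ### Moving D through a product of commuting B's. -/

section Exchange

variable {R V ι : Type*} [CommMonoid R] [AddCommGroup V] [Module ℂ V] [DistribMulAction R V]
  [SMulCommClass ℂ R V] [DecidableEq ι]

/-- The action of `D(v)` on a product of commuting operators `B(u i)` applied to the vacuum. -/
theorem diagonal_smul_prod {a : ℂ} (ha : a ≠ 0) {β : ℂ → R} {D : ℂ → V →ₗ[ℂ] V} {vac : V}
    {d : ℂ → ℂ}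
    (hD : ∀ u v, u ≠ 0 → v ≠ 0 → u ^ 2 ≠ v ^ 2 → ∀ φ, D v (β u • φ)
      = exchF a v u • β u • D v φ + exchG a v u • β v • D u φ)
    (hvac : ∀ u, u ≠ 0 → D u vac = d u • vac)
    (S : Finset ι) (u : ι → ℂ) (hu : ∀ i, u i ≠ 0)
    (huS : ∀ i ∈ S, ∀ j ∈ S, i ≠ j → u i ^ 2 ≠ u j ^ 2) (v : ℂ) (hv : v ≠ 0)
    (hvS : ∀ i ∈ S, v ^ 2 ≠ u i ^ 2) :
    D v ((∏ i ∈ S, β (u i)) • vac)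
      = (d v * ∏ i ∈ S, exchF a v (u i)) • (∏ i ∈ S, β (u i)) • vac
        + ∑ k ∈ S, (exchG a v (u k) * d (u k) * ∏ i ∈ S.erase k, exchF a (u k) (u i)) •
            (β v * ∏ i ∈ S.erase k, β (u i)) • vac := by
  -- The argument v must stay general: exchanging D(v) with B(u i) also produces D(u i), to which
  -- the induction hypothesis is applied.
  induction S using Finset.induction_on generalizing v with
  | empty => simp [hvac v hv]
  | insert i S hi ih =>
    have huS' : ∀ i ∈ S, ∀ j ∈ S, i ≠ j → u i ^ 2 ≠ u j ^ 2 := fun i hi j hj =>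
      huS i (Finset.mem_insert_of_mem hi) j (Finset.mem_insert_of_mem hj)
    have hvi := hvS i (Finset.mem_insert_self _ _)
    have hiS : ∀ k ∈ S, u i ^ 2 ≠ u k ^ 2 := fun k hk =>
      huS i (Finset.mem_insert_self _ _) k (Finset.mem_insert_of_mem hk)
        (fun h => hi (h ▸ hk))
    have hvS' : ∀ k ∈ S, v ^ 2 ≠ u k ^ 2 := fun k hk => hvS k (Finset.mem_insert_of_mem hk)
    rw [Finset.prod_insert hi, mul_smul, hD _ _ (hu i) hv hvi.symm, ih huS' v hv hvS',
      ih huS' (u i) (hu i) hiS, Finset.prod_insert hi, Finset.sum_insert hi,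
      Finset.erase_insert hi]
    have sc : ∀ (r : R) (c : ℂ) (x : V), r • c • x = c • r • x :=
      fun r c x => (smul_comm c r x).symm
    have key : ∀ k ∈ S,
        (exchG a v (u k) * d (u k) * ∏ j ∈ (insert i S).erase k, exchF a (u k) (u j)) •
            (β v * ∏ j ∈ (insert i S).erase k, β (u j)) • vac
        = exchF a v (u i) • β (u i) •
            ((exchG a v (u k) * d (u k) * ∏ j ∈ S.erase k, exchF a (u k) (u j)) •
              (β v * ∏ j ∈ S.erase k, β (u j)) • vac)
          + exchG a v (u i) • β v •
            ((exchG a (u i) (u k) * d (u k) * ∏ j ∈ S.erase k, exchF a (u k) (u j)) •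
              (β (u i) * ∏ j ∈ S.erase k, β (u j)) • vac) := by
      intro k hk
      have hik : i ≠ k := fun h => hi (h ▸ hk)
      have hie : i ∉ S.erase k := fun h => hi (Finset.mem_of_mem_erase h)
      rw [Finset.erase_insert_of_ne hik, Finset.prod_insert hie, Finset.prod_insert hie,
        sc (β (u i)), sc (β v), smul_smul (β (u i)), smul_smul (β v),
        mul_left_comm (β (u i)) (β v)]
      generalize (β v * (β (u i) * ∏ j ∈ S.erase k, β (u j))) • vac = X
      match_scalars
      linear_combination (-d (u k) * ∏ j ∈ S.erase k, exchF a (u k) (u j)) *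
        exchF_add_exchG_chain ha hvi (hvS' k hk) (hiS k hk)
    rw [Finset.sum_congr rfl key, Finset.sum_add_distrib]
    simp only [smul_add, Finset.smul_sum, sc, smul_smul, mul_comm, mul_left_comm, mul_assoc]
    abel

end Exchange

/-! ### Products over ordered pairs of indices. -/

section PairProducts

variable {ι : Type*} [LinearOrder ι]

/-- The product of `h i j` over the pairs `i < j` in `S`. -/
def pairProd (S : Finset ι) (h : ι → ι → ℂ) : ℂ :=
  ∏ i ∈ S, ∏ j ∈ S, if i < j then h i j else 1

theorem pairProd_congr {S : Finset ι} {h h' : ι → ι → ℂ}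
    (hh : ∀ i ∈ S, ∀ j ∈ S, h i j = h' i j) : pairProd S h = pairProd S h' :=
  Finset.prod_congr rfl fun i hi => Finset.prod_congr rfl fun j hj => by rw [hh i hi j hj]

theorem pairProd_insert {S : Finset ι} {h : ι → ι → ℂ} (hsymm : ∀ i j, h i j = h j i) {k : ι}
    (hk : k ∉ S) : pairProd (insert k S) h = (∏ i ∈ S, h k i) * pairProd S h := by
  unfold pairProd
  rw [Finset.prod_insert hk, Finset.prod_insert hk]
  simp only [lt_self_iff_false, if_false, one_mul]
  simp only [Finset.prod_insert hk]
  rw [Finset.prod_mul_distrib, ← mul_assoc, ← Finset.prod_mul_distrib]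
  congr 1
  refine Finset.prod_congr rfl fun i hi => ?_
  have hne : k ≠ i := fun h => hk (h ▸ hi)
  rcases lt_or_gt_of_ne hne with hlt | hlt
  · simp [hlt, hlt.not_gt]
  · simp [hlt, hlt.not_gt, hsymm k i]

theorem pairProd_comp {κ : Type*} [LinearOrder κ] {h : ι → ι → ℂ}
    (hsymm : ∀ i j, h i j = h j i) (S : Finset κ) {σ : κ → ι} (hσ : Function.Injective σ) :
    pairProd S (fun i j => h (σ i) (σ j)) = pairProd (S.image σ) h := by
  induction S using Finset.induction_on with
  | empty => simp [pairProd]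
  | insert k S hk ih =>
    rw [pairProd_insert (fun i j => hsymm _ _) hk, ih, Finset.image_insert,
      pairProd_insert hsymm, Finset.prod_image fun x _ y _ hxy => hσ hxy]
    simpa [hσ.eq_iff] using hk

theorem prod_Ioi_eq_pairProd {N : ℕ} (h : Fin N → Fin N → ℂ) :
    ∏ j, ∏ k ∈ Finset.Ioi j, h j k = pairProd Finset.univ h := by
  refine Finset.prod_congr rfl fun j _ => ?_
  rw [← Finset.prod_filter]
  exact Finset.prod_congr (by ext; simp) fun _ _ => rfl

theorem prod_Ioi_succ {N : ℕ} (h : Fin (N + 1) → Fin (N + 1) → ℂ) :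
    ∏ j, ∏ k ∈ Finset.Ioi j, h j k
      = (∏ k : Fin N, h 0 k.succ) * ∏ j : Fin N, ∏ k ∈ Finset.Ioi j, h j.succ k.succ := by
  rw [Fin.prod_univ_succ, Fin.prod_Ioi_zero]
  simp only [Fin.prod_Ioi_succ]

end PairProducts

/-! ### Scalar identities for the reflecting end. -/

/-- Both sides depend only on u²v². Hence the pair product in `bulkCoeff` ignores the order of the
indices: any index can be split off from it, and it is invariant under permutations. -/
theorem exchF_inv_symm (a : ℂ) {u v : ℂ} (hu : u ≠ 0) (hv : v ≠ 0) :
    exchF a u⁻¹ v = exchF a v⁻¹ u := by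
  have key : ∀ x y : ℂ, x ≠ 0 → exchF a x⁻¹ y
      = -((a ^ 2 * x ^ 2 * y ^ 2 - (a ^ 2)⁻¹) / (x ^ 2 * y ^ 2 - 1)) := by
    intro x y hx
    have hx2 : x ^ 2 ≠ 0 := pow_ne_zero 2 hx
    unfold exchF
    rw [← mul_div_mul_left _ _ hx2]
    congr 2 <;> field_simp
  rw [key u v hu, key v u hv]
  congr 2 <;> ring

/-- The factor attached to a single spectral parameter by the reflecting end. -/
noncomputable def boundaryCoeff (a b u : ℂ) : ℂ :=
  (b * a⁻¹ * u⁻¹ - b⁻¹ * a * u) / (u ^ 2 - (u ^ 2)⁻¹)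

/-- The identity behind the cancellation of unwanted terms: its four summands are the sign choices
for the new parameter x and for the parameter y that D has swapped with. -/
theorem boundaryCoeff_exchG_cancel {a b x y : ℂ} (ha : a ≠ 0) (hb : b ≠ 0) (hx : x ≠ 0)
    (hy : y ≠ 0) (hx4 : x ^ 4 ≠ 1) (hy4 : y ^ 4 ≠ 1) (hxy : x ^ 2 ≠ y ^ 2)
    (hxy' : x ^ 2 * y ^ 2 ≠ 1) :
    boundaryCoeff a b y *
        (boundaryCoeff a b x * exchG a x⁻¹ y + boundaryCoeff a b x⁻¹ * exchG a x y)
      + boundaryCoeff a b y⁻¹ *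
        (boundaryCoeff a b x * exchG a x⁻¹ y⁻¹ + boundaryCoeff a b x⁻¹ * exchG a x y⁻¹) = 0 := by
  have h1 : x ^ 4 - 1 ≠ 0 := sub_ne_zero.2 hx4
  have h2 : y ^ 4 - 1 ≠ 0 := sub_ne_zero.2 hy4
  have h3 : x ^ 2 - y ^ 2 ≠ 0 := sub_ne_zero.2 hxy
  have h4 : x ^ 2 * y ^ 2 - 1 ≠ 0 := sub_ne_zero.2 hxy'
  have hc : ∀ t : ℂ, t ≠ 0 → t ^ 4 - 1 ≠ 0 → boundaryCoeff a b t
      = (b ^ 2 - a ^ 2 * t ^ 2) * t / (a * b * (t ^ 4 - 1)) := by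
    intro t ht ht4
    have e : t ^ 2 - (t ^ 2)⁻¹ = (t ^ 4 - 1) / t ^ 2 := by field_simp
    unfold boundaryCoeff
    rw [e]
    field_simp
  have hc' : ∀ t : ℂ, t ≠ 0 → t ^ 4 - 1 ≠ 0 → boundaryCoeff a b t⁻¹
      = -(b ^ 2 * t ^ 2 - a ^ 2) * t / (a * b * (t ^ 4 - 1)) := by
    intro t ht ht4
    have e : t⁻¹ ^ 2 - (t⁻¹ ^ 2)⁻¹ = -(t ^ 4 - 1) / t ^ 2 := by field_simp; ring
    unfold boundaryCoeff
    rw [e]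
    field_simp
  have g1 : exchG a x⁻¹ y = (a ^ 2 - (a ^ 2)⁻¹) * (x * y) / (x ^ 2 * y ^ 2 - 1) := by
    have e : y ^ 2 - x⁻¹ ^ 2 = (x ^ 2 * y ^ 2 - 1) / x ^ 2 := by field_simp
    unfold exchG; rw [e]; field_simp
  have g2 : exchG a x y = -((a ^ 2 - (a ^ 2)⁻¹) * (x * y) / (x ^ 2 - y ^ 2)) := by
    have e : y ^ 2 - x ^ 2 = -(x ^ 2 - y ^ 2) := by ring
    unfold exchG; rw [e]; field_simp
  have g3 : exchG a x⁻¹ y⁻¹ = (a ^ 2 - (a ^ 2)⁻¹) * (x * y) / (x ^ 2 - y ^ 2) := by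
    have e : y⁻¹ ^ 2 - x⁻¹ ^ 2 = (x ^ 2 - y ^ 2) / (x ^ 2 * y ^ 2) := by field_simp
    unfold exchG; rw [e]; field_simp
  have g4 : exchG a x y⁻¹ = -((a ^ 2 - (a ^ 2)⁻¹) * (x * y) / (x ^ 2 * y ^ 2 - 1)) := by
    have e : y⁻¹ ^ 2 - x ^ 2 = -((x ^ 2 * y ^ 2 - 1) / y ^ 2) := by field_simp; ring
    unfold exchG; rw [e]; field_simp
  rw [hc x hx h1, hc y hy h2, hc' x hx h1, hc' y hy h2, g1, g2, g3, g4]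
  generalize a ^ 2 - (a ^ 2)⁻¹ = c
  have h5 : y ^ 2 * x ^ 2 - 1 ≠ 0 := by rwa [mul_comm]
  field_simp
  ring

/-- These are the coefficients of B(z)D(z⁻¹) and B(z⁻¹)D(z) in ℬ(z) once D(z⁻¹)B(z) is reordered.
The boundary covector is such that z ↦ z⁻¹ interchanges them up to a common prefactor. -/
theorem kCovector_exchange {a b z : ℂ} (ha : a ≠ 0) (hb : b ≠ 0) (hz : z ≠ 0) (hz4 : z ^ 4 ≠ 1) :
    kCovector a b z (1, 0) * exchF a z⁻¹ z
        = (-(a ^ 2) * z ^ 2 + (a ^ 2)⁻¹ * (z ^ 2)⁻¹) * boundaryCoeff a b z ∧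
      kCovector a b z (0, 1) + kCovector a b z (1, 0) * exchG a z⁻¹ z
        = (-(a ^ 2) * z ^ 2 + (a ^ 2)⁻¹ * (z ^ 2)⁻¹) * boundaryCoeff a b z⁻¹ := by
  have h1 : z ^ 4 - 1 ≠ 0 := sub_ne_zero.2 hz4
  have e1 : z ^ 2 - z⁻¹ ^ 2 = (z ^ 4 - 1) / z ^ 2 := by field_simp
  have e2 : z ^ 2 - (z ^ 2)⁻¹ = (z ^ 4 - 1) / z ^ 2 := by field_simp
  have e3 : z⁻¹ ^ 2 - (z⁻¹ ^ 2)⁻¹ = -(z ^ 4 - 1) / z ^ 2 := by field_simp; ring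
  have k1 : kCovector a b z (1, 0) = b * a⁻¹ * z⁻¹ - b⁻¹ * a * z := rfl
  have k2 : kCovector a b z (0, 1) = b * a * z - b⁻¹ * a⁻¹ * z⁻¹ := rfl
  unfold exchF exchG boundaryCoeff
  rw [e1, e2, e3, k1, k2]
  constructor <;> field_simp <;> ring

section SignedPowers

theorem zpow_units_sq_ne {x y : ℂ} (hy : y ≠ 0) (hxy : x ^ 2 ≠ y ^ 2)
    (hxy' : x ^ 2 * y ^ 2 ≠ 1) (s t : ℤˣ) : (x ^ (s : ℤ)) ^ 2 ≠ (y ^ (t : ℤ)) ^ 2 := by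
  have hy2 : y ^ 2 ≠ 0 := pow_ne_zero 2 hy
  rcases Int.units_eq_one_or s with rfl | rfl <;> rcases Int.units_eq_one_or t with rfl | rfl
  · simpa using hxy
  · simpa [← mul_eq_one_iff_eq_inv₀ hy2] using hxy'
  · simpa [inv_eq_iff_eq_inv, ← mul_eq_one_iff_eq_inv₀ hy2] using hxy'
  · simpa using hxy

theorem zpow_neg_units (x : ℂ) (s : ℤˣ) : x ^ ((-s : ℤˣ) : ℤ) = (x ^ (s : ℤ))⁻¹ := by
  simp

theorem zpow_units_pow_four_ne {x : ℂ} (hx4 : x ^ 4 ≠ 1) (s : ℤˣ) : (x ^ (s : ℤ)) ^ 4 ≠ 1 := by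
  rcases Int.units_eq_one_or s with rfl | rfl <;> simpa using hx4

theorem sum_units_int {V : Type*} [AddCommMonoid V] (h : ℤˣ → V) : ∑ s, h s = h 1 + h (-1) := by
  rw [UnitsInt.univ, Finset.sum_pair (by decide)]

end SignedPowers

/-! ### Double-row operators as sums over signs of single-row operators. -/

/-- The coefficient of `B(u 0) B(u 1) ⋯` in the expansion of a product of double-row operators. -/
noncomputable def bulkCoeff (a b : ℂ) (d : ℂ → ℂ) {N : ℕ} (u : Fin N → ℂ) : ℂ :=
  (∏ j, (boundaryCoeff a b (u j) * d (u j)⁻¹)) *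
    pairProd Finset.univ fun i j => exchF a (u i)⁻¹ (u j)

theorem bulkCoeff_succ (a b : ℂ) (d : ℂ → ℂ) {N : ℕ} (u : Fin (N + 1) → ℂ) :
    bulkCoeff a b d u = boundaryCoeff a b (u 0) * (d (u 0)⁻¹ *
      ∏ k : Fin N, exchF a (u 0)⁻¹ (u k.succ)) * bulkCoeff a b d fun k => u k.succ := by
  unfold bulkCoeff
  rw [← prod_Ioi_eq_pairProd, ← prod_Ioi_eq_pairProd, prod_Ioi_succ, Fin.prod_univ_succ]
  ring

theorem bulkCoeff_erase (a b : ℂ) (d : ℂ → ℂ) {N : ℕ} (u : Fin N → ℂ) (hu : ∀ i, u i ≠ 0)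
    (k : Fin N) :
    bulkCoeff a b d u = boundaryCoeff a b (u k) * d (u k)⁻¹ *
      (∏ i ∈ Finset.univ.erase k, exchF a (u k)⁻¹ (u i)) *
      ((∏ j ∈ Finset.univ.erase k, (boundaryCoeff a b (u j) * d (u j)⁻¹)) *
        pairProd (Finset.univ.erase k) fun i j => exchF a (u i)⁻¹ (u j)) := by
  unfold bulkCoeff
  conv_lhs => rw [← Finset.insert_erase (Finset.mem_univ k)]
  rw [pairProd_insert (fun i j => exchF_inv_symm a (hu i) (hu j)) (Finset.notMem_erase _ _),
    Finset.prod_insert (Finset.notMem_erase _ _)]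
  ring

section Boundary

variable {R V : Type*} [CommMonoid R] [AddCommGroup V] [Module ℂ V] [DistribMulAction R V]

/-- The double-row operator built from single-row operators `B` and `D`. -/
noncomputable def doubleRowOp (a b : ℂ) (B D : ℂ → Module.End ℂ V) (z : ℂ) : Module.End ℂ V :=
  kCovector a b z (0, 1) • (B z⁻¹ * D z) + kCovector a b z (1, 0) • (D z⁻¹ * B z)

theorem doubleRowOp_apply {a b : ℂ} (ha : a ≠ 0) (hb : b ≠ 0) {β : ℂ → R}
    {B D : ℂ → Module.End ℂ V} (hB : ∀ u, u ≠ 0 → ∀ φ, B u φ = β u • φ)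
    (hD : ∀ u v, u ≠ 0 → v ≠ 0 → u ^ 2 ≠ v ^ 2 → ∀ φ, D v (β u • φ)
      = exchF a v u • β u • D v φ + exchG a v u • β v • D u φ)
    {z : ℂ} (hz : z ≠ 0) (hz4 : z ^ 4 ≠ 1) (φ : V) :
    doubleRowOp a b B D z φ = (-(a ^ 2) * z ^ 2 + (a ^ 2)⁻¹ * (z ^ 2)⁻¹) •
      ∑ s : ℤˣ, boundaryCoeff a b (z ^ (s : ℤ)) •
        β (z ^ (s : ℤ)) • D (z ^ (s : ℤ))⁻¹ φ := by
  have hne : z ^ 2 ≠ z⁻¹ ^ 2 := by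
    intro h
    apply hz4
    field_simp at h
    linear_combination h
  obtain ⟨e1, e2⟩ := kCovector_exchange ha hb hz hz4
  rw [sum_units_int]
  simp only [doubleRowOp, LinearMap.add_apply, LinearMap.smul_apply, Module.End.mul_apply,
    hB _ hz, hB _ (inv_ne_zero hz), hD z z⁻¹ hz (inv_ne_zero hz) hne, Units.val_one, zpow_one,
    Units.val_neg, zpow_neg, inv_inv, smul_add, smul_smul, ← e1, ← e2, add_smul]
  abel

variable [SMulCommClass ℂ R V]

/-- When D has swapped its argument with the k-th B, the remaining operator is B(z₀)B(z₀⁻¹)∏_{i≠k}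
B(z i ^ τ i), which depends neither on s nor on τ k. The scalar factors other than `boundaryCoeff`
and `exchG` are also invariant under inverting z k ^ τ k, so the sum over these two signs is a
multiple of `boundaryCoeff_exchG_cancel`. -/
theorem unwanted_terms_cancel {a b : ℂ} (ha : a ≠ 0) (hb : b ≠ 0) {β : ℂ → R} {vac : V}
    {d : ℂ → ℂ} {z₀ : ℂ} (hz₀ : z₀ ≠ 0) (hz₀4 : z₀ ^ 4 ≠ 1) {N : ℕ} {z : Fin N → ℂ}
    (hz : ∀ j, z j ≠ 0) (hz4 : ∀ j, z j ^ 4 ≠ 1)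
    (hzz : ∀ j, z₀ ^ 2 ≠ z j ^ 2 ∧ z₀ ^ 2 * z j ^ 2 ≠ 1) (k : Fin N) :
    ∑ s : ℤˣ, ∑ τ : Fin N → ℤˣ, boundaryCoeff a b (z₀ ^ (s : ℤ)) • β (z₀ ^ (s : ℤ)) •
      bulkCoeff a b d (fun j => z j ^ (τ j : ℤ)) •
        (exchG a (z₀ ^ (s : ℤ))⁻¹ (z k ^ (τ k : ℤ)) * d (z k ^ (τ k : ℤ)) *
          ∏ i ∈ Finset.univ.erase k, exchF a (z k ^ (τ k : ℤ)) (z i ^ (τ i : ℤ))) •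
        (β (z₀ ^ (s : ℤ))⁻¹ * ∏ i ∈ Finset.univ.erase k, β (z i ^ (τ i : ℤ))) • vac = 0 := by
  have sc : ∀ (r : R) (c : ℂ) (x : V), r • c • x = c • r • x :=
    fun r c x => (smul_comm c r x).symm
  rw [Finset.sum_comm]
  have key : ∀ τ : Fin N → ℤˣ,
      ∑ s : ℤˣ, boundaryCoeff a b (z₀ ^ (s : ℤ)) • β (z₀ ^ (s : ℤ)) •
      bulkCoeff a b d (fun j => z j ^ (τ j : ℤ)) •
        (exchG a (z₀ ^ (s : ℤ))⁻¹ (z k ^ (τ k : ℤ)) * d (z k ^ (τ k : ℤ)) *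
          ∏ i ∈ Finset.univ.erase k, exchF a (z k ^ (τ k : ℤ)) (z i ^ (τ i : ℤ))) •
        (β (z₀ ^ (s : ℤ))⁻¹ * ∏ i ∈ Finset.univ.erase k, β (z i ^ (τ i : ℤ))) • vac
      = (boundaryCoeff a b (z k ^ (τ k : ℤ)) *
          (boundaryCoeff a b z₀ * exchG a z₀⁻¹ (z k ^ (τ k : ℤ))
            + boundaryCoeff a b z₀⁻¹ * exchG a z₀ (z k ^ (τ k : ℤ)))) •
        ((d (z k ^ (τ k : ℤ)) * d (z k ^ (τ k : ℤ))⁻¹) *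
          (∏ i ∈ Finset.univ.erase k, (exchF a (z k ^ (τ k : ℤ)) (z i ^ (τ i : ℤ)) *
            exchF a (z k ^ (τ k : ℤ))⁻¹ (z i ^ (τ i : ℤ)))) *
          ((∏ j ∈ Finset.univ.erase k,
            (boundaryCoeff a b (z j ^ (τ j : ℤ)) * d (z j ^ (τ j : ℤ))⁻¹)) *
          pairProd (Finset.univ.erase k) fun i j =>
            exchF a (z i ^ (τ i : ℤ))⁻¹ (z j ^ (τ j : ℤ)))) •
        (β z₀ * β z₀⁻¹ * ∏ i ∈ Finset.univ.erase k, β (z i ^ (τ i : ℤ))) • vac := by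
    intro τ
    rw [sum_units_int, bulkCoeff_erase a b d _ (fun i => zpow_ne_zero _ (hz i)) k]
    simp only [Finset.prod_mul_distrib, sc, smul_smul, Units.val_one, zpow_one, Units.val_neg, zpow_neg, inv_inv,
      ← mul_assoc, mul_comm (β z₀⁻¹) (β z₀)]
    rw [← add_smul]
    congr 1
    ring
  rw [Finset.sum_congr rfl fun τ _ => key τ]
  have flip_ne : ∀ (τ : Fin N → ℤˣ), ∀ i ∈ Finset.univ.erase k,
      Function.update τ k (-τ k) i = τ i := fun τ i hi =>
    Function.update_of_ne (Finset.ne_of_mem_erase hi) _ _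
  -- The sum over s is already done; the terms for τ are now paired by reversing the sign τ k.
  refine Finset.sum_involution (fun τ _ => Function.update τ k (-τ k)) ?_ ?_ ?_ ?_
  · intro τ _
    have hk : Function.update τ k (-τ k) k = -τ k := Function.update_self _ _ _
    have p1 : (∏ i ∈ Finset.univ.erase k,
        (exchF a (z k ^ (τ k : ℤ))⁻¹ (z i ^ (Function.update τ k (-τ k) i : ℤ)) *
          exchF a (z k ^ (τ k : ℤ)) (z i ^ (Function.update τ k (-τ k) i : ℤ))))
        = ∏ i ∈ Finset.univ.erase k, (exchF a (z k ^ (τ k : ℤ)) (z i ^ (τ i : ℤ)) *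
            exchF a (z k ^ (τ k : ℤ))⁻¹ (z i ^ (τ i : ℤ))) :=
      Finset.prod_congr rfl fun i hi => by rw [flip_ne τ i hi, mul_comm]
    have p2 : (∏ j ∈ Finset.univ.erase k,
        (boundaryCoeff a b (z j ^ (Function.update τ k (-τ k) j : ℤ)) *
          d (z j ^ (Function.update τ k (-τ k) j : ℤ))⁻¹))
        = ∏ j ∈ Finset.univ.erase k,
            (boundaryCoeff a b (z j ^ (τ j : ℤ)) * d (z j ^ (τ j : ℤ))⁻¹) :=
      Finset.prod_congr rfl fun i hi => by rw [flip_ne τ i hi]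
    have p3 : (pairProd (Finset.univ.erase k) fun i j =>
        exchF a (z i ^ (Function.update τ k (-τ k) i : ℤ))⁻¹
          (z j ^ (Function.update τ k (-τ k) j : ℤ)))
        = pairProd (Finset.univ.erase k) fun i j =>
            exchF a (z i ^ (τ i : ℤ))⁻¹ (z j ^ (τ j : ℤ)) :=
      pairProd_congr fun i hi j hj => by rw [flip_ne τ i hi, flip_ne τ j hj]
    have p4 : (∏ i ∈ Finset.univ.erase k, β (z i ^ (Function.update τ k (-τ k) i : ℤ)))
        = ∏ i ∈ Finset.univ.erase k, β (z i ^ (τ i : ℤ)) :=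
      Finset.prod_congr rfl fun i hi => by rw [flip_ne τ i hi]
    simp only [hk, zpow_neg_units, inv_inv]
    rw [p1, p2, p3, p4, mul_comm (d (z k ^ (τ k : ℤ))⁻¹), ← add_smul]
    have h1 := zpow_units_sq_ne (hz k) (hzz k).1 (hzz k).2 1 (τ k)
    have h2 := zpow_units_sq_ne (hz k) (hzz k).1 (hzz k).2 1 (-τ k)
    rw [zpow_neg_units] at h2
    simp only [Units.val_one, zpow_one] at h1 h2
    rw [boundaryCoeff_exchG_cancel ha hb hz₀ (zpow_ne_zero _ (hz k)) hz₀4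
      (zpow_units_pow_four_ne (hz4 k) _) h1, zero_smul]
    intro h
    apply h2
    rw [inv_pow]
    exact eq_inv_of_mul_eq_one_left h
  · intro τ _ _ h
    have := congrFun h k
    rw [Function.update_self] at this
    rcases Int.units_eq_one_or (τ k) with h' | h' <;> rw [h'] at this <;> revert this <;> decide
  · intro τ _
    exact Finset.mem_univ _
  · intro τ _
    simp

/-- A product of double-row operators applied to the vacuum is a sum, over the signs of the
spectral parameters, of products of single-row operators. -/
theorem doubleRowOp_prod_vacuum {a b : ℂ} (ha : a ≠ 0) (hb : b ≠ 0) {β : ℂ → R}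
    {B D : ℂ → Module.End ℂ V} (hB : ∀ u, u ≠ 0 → ∀ φ, B u φ = β u • φ)
    (hD : ∀ u v, u ≠ 0 → v ≠ 0 → u ^ 2 ≠ v ^ 2 → ∀ φ, D v (β u • φ)
      = exchF a v u • β u • D v φ + exchG a v u • β v • D u φ)
    {vac : V} {d : ℂ → ℂ} (hvac : ∀ u, u ≠ 0 → D u vac = d u • vac) {N : ℕ} (z : Fin N → ℂ)
    (hz : ∀ j, z j ≠ 0) (hz4 : ∀ j, z j ^ 4 ≠ 1)
    (hzz : ∀ j k, j ≠ k → z j ^ 2 ≠ z k ^ 2 ∧ z j ^ 2 * z k ^ 2 ≠ 1) :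
    (List.ofFn fun j => doubleRowOp a b B D (z j)).prod vac
      = (∏ j, (-(a ^ 2) * z j ^ 2 + (a ^ 2)⁻¹ * (z j ^ 2)⁻¹)) •
        ∑ τ : Fin N → ℤˣ, bulkCoeff a b d (fun j => z j ^ (τ j : ℤ)) •
          (∏ j, β (z j ^ (τ j : ℤ))) • vac := by
  induction N with
  | zero => simp [bulkCoeff, pairProd]
  | succ N ih =>
    have sc : ∀ (r : R) (c : ℂ) (x : V), r • c • x = c • r • x :=
      fun r c x => (smul_comm c r x).symm
    rw [List.ofFn_succ, List.prod_cons, Module.End.mul_apply,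
      ih (fun j => z j.succ) (fun j => hz _) (fun j => hz4 _)
        (fun j k hjk => hzz _ _ ((Fin.succ_injective N).ne hjk)),
      map_smul, doubleRowOp_apply ha hb hB hD (hz 0) (hz4 0), smul_smul, Fin.prod_univ_succ,
      mul_comm (∏ j : Fin N, _)]
    congr 1
    have hDX : ∀ (s : ℤˣ) (τ : Fin N → ℤˣ),
        D (z 0 ^ (s : ℤ))⁻¹ ((∏ j, β (z j.succ ^ (τ j : ℤ))) • vac) = _ :=
      fun s τ => diagonal_smul_prod ha hD hvac Finset.univ (fun j => z j.succ ^ (τ j : ℤ))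
        (fun i => zpow_ne_zero _ (hz _))
        (fun i _ j _ hij => by
          have h := hzz _ _ ((Fin.succ_injective N).ne hij)
          exact zpow_units_sq_ne (hz _) h.1 h.2 _ _) (z 0 ^ (s : ℤ))⁻¹
        (inv_ne_zero (zpow_ne_zero _ (hz 0)))
        (fun i _ => by
          have h := hzz 0 i.succ (Fin.succ_ne_zero i).symm
          rw [← zpow_neg_units]
          exact zpow_units_sq_ne (hz _) h.1 h.2 _ _)
    simp only [map_sum, map_smul, hDX, smul_add, Finset.sum_add_distrib, Finset.smul_sum]
    -- Only the wanted terms survive, and they supply the recursion `bulkCoeff_succ`.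
    have hcancel : ∑ s : ℤˣ, ∑ τ : Fin N → ℤˣ, ∑ k : Fin N,
        boundaryCoeff a b (z 0 ^ (s : ℤ)) • β (z 0 ^ (s : ℤ)) •
        bulkCoeff a b d (fun j => z j.succ ^ (τ j : ℤ)) •
        (exchG a (z 0 ^ (s : ℤ))⁻¹ (z k.succ ^ (τ k : ℤ)) * d (z k.succ ^ (τ k : ℤ)) *
          ∏ i ∈ Finset.univ.erase k, exchF a (z k.succ ^ (τ k : ℤ)) (z i.succ ^ (τ i : ℤ))) •
        (β (z 0 ^ (s : ℤ))⁻¹ * ∏ i ∈ Finset.univ.erase k, β (z i.succ ^ (τ i : ℤ))) • vac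
        = 0 := by
      rw [Finset.sum_congr rfl fun s _ => Finset.sum_comm, Finset.sum_comm]
      exact Finset.sum_eq_zero fun k _ => unwanted_terms_cancel ha hb (hz 0) (hz4 0)
        (fun j => hz _) (fun j => hz4 _) (fun j => hzz 0 j.succ (Fin.succ_ne_zero j).symm) k
    rw [hcancel, add_zero, ← (Fin.consEquiv fun _ : Fin (N + 1) => ℤˣ).sum_comp,
      Fintype.sum_prod_type]
    refine Finset.sum_congr rfl fun s _ => Finset.sum_congr rfl fun τ _ => ?_
    rw [bulkCoeff_succ, Fin.prod_univ_succ]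
    simp only [Fin.consEquiv_apply, Fin.cons_zero, Fin.cons_succ]
    rw [sc, sc, smul_smul, smul_smul, smul_smul]
    congr 1
    ring

end Boundary

/-! ### Single-row operators and their exchange relations. -/

/-- The `L`-operator with homogeneous column parameters `p, q`; `p = 1`, `q = w` gives
`lMatrix a z w`. -/
noncomputable def homWeight (a p q z : ℂ) : Matrix (Fin 2 × Fin 2) (Fin 2 × Fin 2) ℂ :=
  fun out inp => match out, inp with
    | (0, 0), (0, 0) => equalWeight a p q z
    | (0, 1), (0, 1) => distinctWeight a p q z
    | (0, 1), (1, 0) => a ^ 2 - (a ^ 2)⁻¹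
    | (1, 0), (0, 1) => (a ^ 2 - (a ^ 2)⁻¹) * (p * q)
    | (1, 0), (1, 0) => distinctWeight a p q z
    | (1, 1), (1, 1) => equalWeight a p q z
    | _, _ => 0

/-- The matrix `⟨γ|_a T_a(z) |1⟩_a` with homogeneous column parameters. -/
noncomputable def rowMatrix (a : ℂ) : {M : ℕ} → (p q : Fin M → ℂ) → (z : ℂ) → Fin 2 →
    Matrix (Config M) (Config M) ℂ
  | 0, _, _, _, γ => fun _ _ => if γ = 1 then 1 else 0
  | _ + 1, p, q, z, γ => fun y x => ∑ β, homWeight a (p 0) (q 0) z (γ, y 0) (β, x 0) *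
      rowMatrix a (Fin.tail p) (Fin.tail q) z β (Fin.tail y) (Fin.tail x)

/-- `rowMatrix` as a linear operator. -/
noncomputable def rowOp (a : ℂ) {M : ℕ} (p q : Fin M → ℂ) (γ : Fin 2) (z : ℂ) :
    Module.End ℂ (Config M → ℂ) :=
  (rowMatrix a p q z γ).mulVecLin

/-- The component of a vector in which the first site carries the label `i`. -/
def slice {M : ℕ} (i : Fin 2) : (Config (M + 1) → ℂ) →ₗ[ℂ] (Config M → ℂ) :=
  LinearMap.funLeft ℂ ℂ fun y => (Fin.cons i y : Config (M + 1))

theorem slice_apply {M : ℕ} (i : Fin 2) (φ : Config (M + 1) → ℂ) (y : Config M) :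
    slice i φ y = φ (Fin.cons i y : Config (M + 1)) := rfl

theorem slice_ext {M : ℕ} {φ ψ : Config (M + 1) → ℂ} (h0 : slice 0 φ = slice 0 ψ)
    (h1 : slice 1 φ = slice 1 ψ) : φ = ψ := by
  funext y
  rw [← Fin.cons_self_tail y]
  have h : ∀ i, slice i φ = slice i ψ := by
    intro i
    fin_cases i
    · exact h0
    · exact h1
  exact congrFun (h (y 0)) (Fin.tail y)

theorem slice_rowOp (a : ℂ) {M : ℕ} (p q : Fin (M + 1) → ℂ) (γ i : Fin 2) (z : ℂ)
    (φ : Config (M + 1) → ℂ) :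
    slice i (rowOp a p q γ z φ) = ∑ j, ∑ β, homWeight a (p 0) (q 0) z (γ, i) (β, j) •
      rowOp a (Fin.tail p) (Fin.tail q) β z (slice j φ) := by
  funext y
  simp only [slice_apply, rowOp, Matrix.mulVecLin_apply, Matrix.mulVec, dotProduct,
    Finset.sum_apply, Pi.smul_apply, smul_eq_mul]
  rw [← (Fin.consEquiv fun _ : Fin (M + 1) => Fin 2).sum_comp, Fintype.sum_prod_type]
  refine Finset.sum_congr rfl fun j _ => ?_
  simp only [rowMatrix, Fin.consEquiv_apply, Fin.cons_zero, Fin.tail_cons, Finset.mul_sum,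
    Finset.sum_mul]
  rw [Finset.sum_comm]
  simp only [mul_assoc]
  rfl

section Slices

variable (a : ℂ) {M : ℕ} (p q : Fin (M + 1) → ℂ) (z : ℂ) (φ : Config (M + 1) → ℂ)

theorem slice_zero_B : slice 0 (rowOp a p q 0 z φ) = equalWeight a (p 0) (q 0) z •
    rowOp a (Fin.tail p) (Fin.tail q) 0 z (slice 0 φ) := by
  simp [slice_rowOp, homWeight]

theorem slice_one_B : slice 1 (rowOp a p q 0 z φ) = distinctWeight a (p 0) (q 0) z •
      rowOp a (Fin.tail p) (Fin.tail q) 0 z (slice 1 φ)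
    + (a ^ 2 - (a ^ 2)⁻¹) • rowOp a (Fin.tail p) (Fin.tail q) 1 z (slice 0 φ) := by
  simp [slice_rowOp, homWeight, add_comm]

theorem slice_zero_D : slice 0 (rowOp a p q 1 z φ) = distinctWeight a (p 0) (q 0) z •
      rowOp a (Fin.tail p) (Fin.tail q) 1 z (slice 0 φ)
    + ((a ^ 2 - (a ^ 2)⁻¹) * (p 0 * q 0)) •
      rowOp a (Fin.tail p) (Fin.tail q) 0 z (slice 1 φ) := by
  simp [slice_rowOp, homWeight]

theorem slice_one_D : slice 1 (rowOp a p q 1 z φ) = equalWeight a (p 0) (q 0) z •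
    rowOp a (Fin.tail p) (Fin.tail q) 1 z (slice 1 φ) := by
  simp [slice_rowOp, homWeight]

end Slices

theorem rowOp_zero_B (a : ℂ) (p q : Fin 0 → ℂ) (z : ℂ) : rowOp a p q 0 z = 0 := by
  refine LinearMap.ext fun φ => funext fun y => ?_
  simp only [rowOp, Matrix.mulVecLin_apply, Matrix.mulVec, dotProduct]
  simp [rowMatrix]

theorem rowOp_zero_D (a : ℂ) (p q : Fin 0 → ℂ) (z : ℂ) : rowOp a p q 1 z = 1 := by
  refine LinearMap.ext fun φ => funext fun y => ?_
  simp only [rowOp, Matrix.mulVecLin_apply, Matrix.mulVec, dotProduct]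
  simp only [rowMatrix, if_true, one_mul, Fintype.sum_unique]
  exact congrArg φ (Subsingleton.elim _ _)

theorem equalWeight_neg (a p q z : ℂ) : equalWeight a p q (-z) = -equalWeight a p q z := by
  unfold equalWeight
  rw [inv_neg]
  ring

theorem distinctWeight_neg (a p q z : ℂ) :
    distinctWeight a p q (-z) = -distinctWeight a p q z := by
  unfold distinctWeight
  rw [inv_neg]
  ring

theorem rowOp_neg (a : ℂ) {M : ℕ} (p q : Fin M → ℂ) (z : ℂ) (φ : Config M → ℂ) :
    rowOp a p q 0 (-z) φ = (-1 : ℂ) ^ (M + 1) • rowOp a p q 0 z φ ∧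
      rowOp a p q 1 (-z) φ = (-1 : ℂ) ^ M • rowOp a p q 1 z φ := by
  induction M with
  | zero => simp [rowOp_zero_B, rowOp_zero_D]
  | succ M ih =>
    have hB := fun φ => (ih (Fin.tail p) (Fin.tail q) φ).1
    have hD := fun φ => (ih (Fin.tail p) (Fin.tail q) φ).2
    constructor <;> refine slice_ext ?_ ?_ <;>
    simp only [slice_zero_B, slice_one_B, slice_zero_D, slice_one_D, map_smul, hB, hD,
      equalWeight_neg, distinctWeight_neg, pow_succ] <;>
    module

/-- The exchange relations of the operators `B(u)` and `D(u)`. -/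
theorem rowOp_exchange {a : ℂ} (ha : a ≠ 0) {M : ℕ} (p q : Fin M → ℂ) {u v : ℂ} (hu : u ≠ 0)
    (hv : v ≠ 0) (huv : u ^ 2 ≠ v ^ 2) (φ : Config M → ℂ) :
    rowOp a p q 0 u (rowOp a p q 0 v φ) = rowOp a p q 0 v (rowOp a p q 0 u φ) ∧
    rowOp a p q 1 u (rowOp a p q 1 v φ) = rowOp a p q 1 v (rowOp a p q 1 u φ) ∧
    rowOp a p q 1 v (rowOp a p q 0 u φ) = exchF a v u • rowOp a p q 0 u (rowOp a p q 1 v φ)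
      + exchG a v u • rowOp a p q 0 v (rowOp a p q 1 u φ) ∧
    rowOp a p q 1 u (rowOp a p q 0 v φ) = exchF a u v • rowOp a p q 0 v (rowOp a p q 1 u φ)
      + exchG a u v • rowOp a p q 0 u (rowOp a p q 1 v φ) := by
  have h1 : u ^ 2 - v ^ 2 ≠ 0 := sub_ne_zero.2 huv
  have h2 : v ^ 2 - u ^ 2 = -(u ^ 2 - v ^ 2) := by ring
  induction M with
  | zero =>
    simp [rowOp_zero_B, rowOp_zero_D]
  | succ M ih =>
    have hBB := fun φ => (ih (Fin.tail p) (Fin.tail q) φ).1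
    have hDD := fun φ => (ih (Fin.tail p) (Fin.tail q) φ).2.1
    have hDB := fun φ => (ih (Fin.tail p) (Fin.tail q) φ).2.2.1
    have hDB' := fun φ => (ih (Fin.tail p) (Fin.tail q) φ).2.2.2
    -- Each slice of either side is a combination of words in the operators of the remaining sites.
    -- The four inductive relations bring these to a common order, and rational identities in u and
    -- v remain. The relations feed into one another, hence the joint induction.
    refine ⟨?_, ?_, ?_, ?_⟩ <;> refine slice_ext ?_ ?_ <;>
    simp only [slice_zero_B, slice_one_B, slice_zero_D, slice_one_D, map_add, map_smul,
      hBB, hDD, hDB, hDB'] <;>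
    match_scalars <;>
    simp only [exchF, exchG, equalWeight, distinctWeight, h2] <;>
    field_simp <;> ring

/-- The exchange relation excludes u² = v², but then v = ±u, and B(-u) is B(u) up to sign. -/
theorem rowOp_B_comm {a : ℂ} (ha : a ≠ 0) {M : ℕ} (p q : Fin M → ℂ) {u v : ℂ} (hu : u ≠ 0)
    (hv : v ≠ 0) : rowOp a p q 0 u * rowOp a p q 0 v = rowOp a p q 0 v * rowOp a p q 0 u := by
  refine LinearMap.ext fun φ => ?_
  simp only [Module.End.mul_apply]
  by_cases huv : u ^ 2 = v ^ 2
  · rcases sq_eq_sq_iff_eq_or_eq_neg.1 huv with rfl | rfl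
    · rfl
    · simp only [(rowOp_neg a p q v _).1, map_smul]
  · exact (rowOp_exchange ha p q hu hv huv φ).1

/-- The vector `|0^M⟩`. -/
def vacuum (M : ℕ) : Config M → ℂ := Pi.single (fun _ => 0) 1

theorem slice_zero_vacuum (M : ℕ) : slice 0 (vacuum (M + 1)) = vacuum M := by
  funext y
  have h : (Fin.cons 0 y : Config (M + 1)) = (fun _ => 0) ↔ y = fun _ => 0 := by
    constructor
    · intro h
      funext j
      simpa using congrFun h j.succ
    · rintro rfl
      funext j
      refine Fin.cases ?_ (fun _ => ?_) j <;> simp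
  simp only [slice_apply, vacuum, Pi.single_apply, h]

theorem slice_one_vacuum (M : ℕ) : slice 1 (vacuum (M + 1)) = 0 := by
  funext y
  have h : (Fin.cons 1 y : Config (M + 1)) ≠ fun _ => 0 := by
    intro h
    simpa using congrFun h 0
  simp [slice_apply, vacuum, h]

/-- The eigenvalue of `D(z)` on the vacuum. -/
noncomputable def vacuumValue (a : ℂ) {M : ℕ} (p q : Fin M → ℂ) (z : ℂ) : ℂ :=
  ∏ j, distinctWeight a (p j) (q j) z

theorem rowOp_D_vacuum (a : ℂ) {M : ℕ} (p q : Fin M → ℂ) (z : ℂ) :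
    rowOp a p q 1 z (vacuum M) = vacuumValue a p q z • vacuum M := by
  induction M with
  | zero => simp [rowOp_zero_D, vacuumValue]
  | succ M ih =>
    refine slice_ext ?_ ?_
    · rw [slice_zero_D, map_smul, slice_zero_vacuum, slice_one_vacuum, ih]
      simp [vacuumValue, Fin.prod_univ_succ, mul_smul, Fin.tail]
    · rw [slice_one_D, map_smul, slice_one_vacuum]
      simp

/-- The commuting operators `B(u)` come from the action of a commutative monoid. -/
theorem exists_B_action {a : ℂ} (ha : a ≠ 0) {M : ℕ} (p q : Fin M → ℂ) :
    ∃ (R : Type) (_ : CommMonoid R) (_ : DistribMulAction R (Config M → ℂ))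
      (_ : SMulCommClass ℂ R (Config M → ℂ)) (β : ℂ → R),
      ∀ u, u ≠ 0 → ∀ φ, rowOp a p q 0 u φ = β u • φ := by
  let s : Set (Module.End ℂ (Config M → ℂ)) := {T | ∃ u, u ≠ 0 ∧ T = rowOp a p q 0 u}
  have hs : ∀ S ∈ s, ∀ T ∈ s, S * T = T * S := by
    rintro _ ⟨u, hu, rfl⟩ _ ⟨v, hv, rfl⟩
    exact rowOp_B_comm ha p q hu hv
  have hcomm := Submonoid.isMulCommutative_closure _ hs
  let _ : CommMonoid (Submonoid.closure s) :=
    { (inferInstance : Monoid (Submonoid.closure s)) with mul_comm := hcomm.is_comm.comm }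
  refine ⟨Submonoid.closure s, inferInstance, inferInstance, ⟨?_⟩,
    fun u => if hu : u ≠ 0 then ⟨rowOp a p q 0 u, Submonoid.subset_closure ⟨u, hu, rfl⟩⟩ else 1,
    ?_⟩
  · intro c T φ
    exact (map_smul T.1 c φ).symm
  · intro u hu φ
    simp only [dif_pos hu]
    rfl

theorem B_action_exchange {a : ℂ} (ha : a ≠ 0) {M : ℕ} (p q : Fin M → ℂ) {R : Type}
    [CommMonoid R] [DistribMulAction R (Config M → ℂ)] {β : ℂ → R}
    (hB : ∀ u, u ≠ 0 → ∀ φ, rowOp a p q 0 u φ = β u • φ) (u v : ℂ) (hu : u ≠ 0) (hv : v ≠ 0)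
    (huv : u ^ 2 ≠ v ^ 2) (φ : Config M → ℂ) :
    rowOp a p q 1 v (β u • φ) = exchF a v u • β u • rowOp a p q 1 v φ
      + exchG a v u • β v • rowOp a p q 1 u φ := by
  rw [← hB u hu, ← hB u hu, ← hB v hv]
  exact (rowOp_exchange ha p q hu hv huv φ).2.2.1

/-! ### The single-row wavefunction. -/

section Bulk

variable {a : ℂ} {M : ℕ} {p q : Fin (M + 1) → ℂ} {ι : Type*} [DecidableEq ι] {R R' : Type}
  [CommMonoid R] [DistribMulAction R (Config (M + 1) → ℂ)]
  [CommMonoid R'] [DistribMulAction R' (Config M → ℂ)] [SMulCommClass ℂ R' (Config M → ℂ)]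
  {β : ℂ → R} {β' : ℂ → R'}

theorem slice_zero_prod_B (hB : ∀ u, u ≠ 0 → ∀ φ, rowOp a p q 0 u φ = β u • φ)
    (hB' : ∀ u, u ≠ 0 → ∀ φ, rowOp a (Fin.tail p) (Fin.tail q) 0 u φ = β' u • φ)
    (S : Finset ι) (u : ι → ℂ) (hu : ∀ i, u i ≠ 0) :
    slice 0 ((∏ i ∈ S, β (u i)) • vacuum (M + 1))
      = (∏ i ∈ S, equalWeight a (p 0) (q 0) (u i)) • (∏ i ∈ S, β' (u i)) • vacuum M := by
  induction S using Finset.induction_on with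
  | empty => simp [slice_zero_vacuum]
  | insert i S hi ih =>
    rw [Finset.prod_insert hi, mul_smul, ← hB _ (hu i), slice_zero_B, ih, hB' _ (hu i),
      ← smul_comm _ (β' (u i)), ← mul_smul, ← mul_smul, Finset.prod_insert hi,
      Finset.prod_insert hi]

/-- Exactly one operator, B(u k), puts the particle on the first site. On the other sites it acts as
D(u k), which yields the vacuum eigenvalue and an `exchF` for each remaining B. The terms where D
swaps its argument are absorbed by `equalWeight_exchange`. -/
theorem slice_one_prod_B (ha : a ≠ 0) (hB : ∀ u, u ≠ 0 → ∀ φ, rowOp a p q 0 u φ = β u • φ)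
    (hB' : ∀ u, u ≠ 0 → ∀ φ, rowOp a (Fin.tail p) (Fin.tail q) 0 u φ = β' u • φ)
    (S : Finset ι) (u : ι → ℂ) (hu : ∀ i, u i ≠ 0)
    (huS : ∀ i ∈ S, ∀ j ∈ S, i ≠ j → u i ^ 2 ≠ u j ^ 2) :
    slice 1 ((∏ i ∈ S, β (u i)) • vacuum (M + 1))
      = ∑ k ∈ S, ((a ^ 2 - (a ^ 2)⁻¹) * vacuumValue a (Fin.tail p) (Fin.tail q) (u k) *
          ∏ i ∈ S.erase k, (exchF a (u k) (u i) * equalWeight a (p 0) (q 0) (u i))) •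
        (∏ i ∈ S.erase k, β' (u i)) • vacuum M := by
  have sc : ∀ (r : R') (c : ℂ) (x : Config M → ℂ), r • c • x = c • r • x :=
    fun r c x => (smul_comm c r x).symm
  induction S using Finset.induction_on with
  | empty => simp [slice_one_vacuum]
  | insert i S hi ih =>
    have huS' : ∀ i ∈ S, ∀ j ∈ S, i ≠ j → u i ^ 2 ≠ u j ^ 2 := fun i hi j hj =>
      huS i (Finset.mem_insert_of_mem hi) j (Finset.mem_insert_of_mem hj)
    have hiS : ∀ k ∈ S, u i ^ 2 ≠ u k ^ 2 := fun k hk =>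
      huS i (Finset.mem_insert_self _ _) k (Finset.mem_insert_of_mem hk)
        (fun h => hi (h ▸ hk))
    rw [Finset.prod_insert hi, mul_smul, ← hB _ (hu i), slice_one_B, ih huS',
      slice_zero_prod_B hB hB' S u hu, map_smul,
      diagonal_smul_prod ha (B_action_exchange ha _ _ hB')
        (fun u _ => rowOp_D_vacuum a _ _ u) S u hu huS' (u i) (hu i) hiS,
      Finset.sum_insert hi, Finset.erase_insert hi, hB' _ (hu i), smul_add, smul_add, add_left_comm]
    congr 1
    · rw [smul_smul, smul_smul, Finset.prod_mul_distrib]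
      congr 1
      ring
    · rw [Finset.smul_sum, Finset.smul_sum, Finset.smul_sum, Finset.smul_sum,
        ← Finset.sum_add_distrib]
      refine Finset.sum_congr rfl fun k hk => ?_
      have hik : i ≠ k := fun h => hi (h ▸ hk)
      have hie : i ∉ S.erase k := fun h => hi (Finset.mem_of_mem_erase h)
      rw [Finset.erase_insert_of_ne hik, Finset.prod_insert hie, Finset.prod_insert hie,
        sc, ← mul_smul (β' (u i)), ← Finset.mul_prod_erase S _ hk, Finset.prod_mul_distrib]
      generalize (β' (u i) * ∏ j ∈ S.erase k, β' (u j)) • vacuum M = X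
      match_scalars
      linear_combination ((a ^ 2 - (a ^ 2)⁻¹) * vacuumValue a (Fin.tail p) (Fin.tail q) (u k) *
        (∏ j ∈ S.erase k, exchF a (u k) (u j)) *
        ∏ j ∈ S.erase k, equalWeight a (p 0) (q 0) (u j)) *
        equalWeight_exchange (p := p 0) (q := q 0) ha (hu i) (hu k) (hiS k hk)

end Bulk

/-- The weight of a row with a single particle, created at the site `i`. -/
noncomputable def siteWeight (a : ℂ) {M : ℕ} (p q : Fin M → ℂ) (i : Fin M) (u : ℂ) : ℂ :=
  (∏ j ∈ Finset.Iio i, equalWeight a (p j) (q j) u) *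
    ∏ j ∈ Finset.Ioi i, distinctWeight a (p j) (q j) u

theorem siteWeight_zero (a : ℂ) {M : ℕ} (p q : Fin (M + 1) → ℂ) (u : ℂ) :
    siteWeight a p q 0 u = vacuumValue a (Fin.tail p) (Fin.tail q) u := by
  have h : Finset.Iio (0 : Fin (M + 1)) = ∅ := by
    ext
    simp
  rw [siteWeight, Fin.prod_Ioi_zero, h]
  simp [vacuumValue, Fin.tail]

theorem siteWeight_succ (a : ℂ) {M : ℕ} (p q : Fin (M + 1) → ℂ) (i : Fin M) (u : ℂ) :
    siteWeight a p q i.succ u = equalWeight a (p 0) (q 0) u *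
      siteWeight a (Fin.tail p) (Fin.tail q) i u := by
  have h : Finset.Iio i.succ = insert 0 ((Finset.Iio i).map (Fin.succEmb M)) := by
    ext j
    refine Fin.cases ?_ (fun j => ?_) j <;> simp
  rw [siteWeight, Fin.prod_Ioi_succ, h, Finset.prod_insert (by simp), Finset.prod_map, siteWeight]
  simp [Fin.tail, mul_assoc]

theorem prod_erase_swap {A : Type*} [CommMonoid A] {N : ℕ} (k : Fin (N + 1))
    (h : Fin (N + 1) → A) :
    ∏ i ∈ Finset.univ.erase k, h i = ∏ i : Fin N, h (Equiv.swap 0 k i.succ) := by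
  have hs : Finset.univ.erase k
      = Finset.univ.map ((Fin.succEmb N).trans (Equiv.swap 0 k).toEmbedding) := by
    ext i
    simp only [Finset.mem_erase, Finset.mem_univ, and_true, Finset.mem_map, true_and,
      Function.Embedding.trans_apply, Fin.coe_succEmb, Equiv.coe_toEmbedding]
    constructor
    · intro hi
      have h0 : Equiv.swap 0 k i ≠ 0 := by
        intro h0
        apply hi
        simpa using congrArg (Equiv.swap 0 k) h0
      obtain ⟨j, hj⟩ := Fin.exists_succ_eq.2 h0
      exact ⟨j, by rw [hj, Equiv.swap_apply_self]⟩
    · rintro ⟨j, rfl⟩ hj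
      have := congrArg (Equiv.swap 0 k) hj
      rw [Equiv.swap_apply_self, Equiv.swap_apply_right] at this
      exact Fin.succ_ne_zero j this
  rw [hs, Finset.prod_map]
  rfl

theorem particles_cons_zero {M N : ℕ} (x : Fin N → Fin M) :
    particles (fun k => (x k).succ) = (Fin.cons 0 (particles x) : Config (M + 1)) := by
  funext j
  refine Fin.cases ?_ (fun j => ?_) j
  · simp [particles]
  · simp [particles]

theorem particles_cons_one {M N : ℕ} (x : Fin N → Fin M) (y : Fin (N + 1) → Fin (M + 1))
    (h0 : y 0 = 0) (hs : ∀ k, y k.succ = (x k).succ) :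
    particles y = (Fin.cons 1 (particles x) : Config (M + 1)) := by
  funext j
  refine Fin.cases ?_ (fun j => ?_) j
  · simpa [particles] using ⟨0, h0⟩
  · simp [particles, Fin.exists_fin_succ, h0, hs, (Fin.succ_ne_zero j).symm]

/-- The components of a product of operators `B(u j)` applied to the vacuum. -/
theorem prod_B_vacuum_apply {a : ℂ} (ha : a ≠ 0) {M N : ℕ} (p q : Fin M → ℂ) {R : Type}
    [CommMonoid R] [DistribMulAction R (Config M → ℂ)] {β : ℂ → R}
    (hB : ∀ u, u ≠ 0 → ∀ φ, rowOp a p q 0 u φ = β u • φ) (u : Fin N → ℂ) (hu : ∀ i, u i ≠ 0)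
    (huu : ∀ i j, i ≠ j → u i ^ 2 ≠ u j ^ 2) (x : Fin N → Fin M) (hx : StrictMono x) :
    ((∏ j, β (u j)) • vacuum M) (particles x) = (a ^ 2 - (a ^ 2)⁻¹) ^ N *
      ∑ σ : Equiv.Perm (Fin N), (∏ j, ∏ k ∈ Finset.Ioi j, exchF a (u (σ j)) (u (σ k))) *
        ∏ k, siteWeight a p q (x k) (u (σ k)) := by
  induction M generalizing N R with
  | zero =>
    cases N with
    | zero => simp [vacuum, Subsingleton.elim (particles x) fun _ => 0]
    | succ N => exact (x 0).elim0
  | succ M ih =>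
    obtain ⟨R', _, _, _, β', hB'⟩ := exists_B_action ha (Fin.tail p) (Fin.tail q)
    by_cases h : ∃ k, x k = 0
    · obtain ⟨k, hk⟩ := h
      cases N with
      | zero => exact k.elim0
      | succ N =>
        -- Since x is increasing, a particle on the first site must be the first particle.
        have h0 : x 0 = 0 := le_antisymm (hk ▸ hx.monotone (Fin.zero_le k)) (Fin.zero_le _)
        have hpos : ∀ k : Fin N, x k.succ ≠ 0 := fun k h => by
          have := hx (Fin.succ_pos k)
          rw [h] at this
          exact absurd this (Fin.not_lt_zero _)
        let y : Fin N → Fin M := fun k => (x k.succ).pred (hpos k)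
        have hxy : ∀ k, x k.succ = (y k).succ := fun k => (Fin.succ_pred _ _).symm
        have hy : StrictMono y := fun i j hij => by
          have := hx (Fin.succ_lt_succ_iff.2 hij)
          rwa [hxy, hxy, Fin.succ_lt_succ_iff] at this
        rw [particles_cons_one y x h0 hxy]
        change slice 1 ((∏ j, β (u j)) • vacuum (M + 1)) (particles y) = _
        -- A permutation σ is split into k = σ 0, the index of the operator creating the first
        -- particle, and a permutation of the other indices.
        rw [slice_one_prod_B ha hB hB' _ _ hu fun i _ j _ hij => huu i j hij,
          ← Equiv.Perm.decomposeFin.symm.sum_comp, Fintype.sum_prod_type, Finset.mul_sum,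
          Finset.sum_apply]
        refine Finset.sum_congr rfl fun k _ => ?_
        have hinj : Function.Injective fun i : Fin N => Equiv.swap 0 k i.succ :=
          (Equiv.swap 0 k).injective.comp (Fin.succ_injective N)
        rw [prod_erase_swap, prod_erase_swap, Pi.smul_apply,
          ih (Fin.tail p) (Fin.tail q) hB' (fun i => u (Equiv.swap 0 k i.succ)) (fun i => hu _)
            (fun i j hij => huu _ _ (hinj.ne hij)) y hy, smul_eq_mul, Finset.mul_sum,
          Finset.mul_sum, Finset.mul_sum]
        refine Finset.sum_congr rfl fun e _ => ?_
        rw [prod_Ioi_succ, Fin.prod_univ_succ]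
        simp only [Equiv.Perm.decomposeFin_symm_apply_zero,
          Equiv.Perm.decomposeFin_symm_apply_succ, h0, hxy, siteWeight_zero, siteWeight_succ,
          Finset.prod_mul_distrib]
        rw [Equiv.prod_comp e fun i => exchF a (u k) (u (Equiv.swap 0 k i.succ)),
          Equiv.prod_comp e fun i => equalWeight a (p 0) (q 0) (u (Equiv.swap 0 k i.succ))]
        ring
    · push Not at h
      let y : Fin N → Fin M := fun k => (x k).pred (h k)
      have hxy : x = fun k => (y k).succ := funext fun k => (Fin.succ_pred _ _).symm
      have hy : StrictMono y := fun i j hij => by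
        have := hx hij
        rwa [hxy, Fin.succ_lt_succ_iff] at this
      clear_value y
      subst hxy
      rw [particles_cons_zero]
      change slice 0 ((∏ j, β (u j)) • vacuum (M + 1)) (particles y) = _
      rw [slice_zero_prod_B hB hB' _ _ hu, Pi.smul_apply,
        ih (Fin.tail p) (Fin.tail q) hB' u hu huu y hy, smul_eq_mul, mul_left_comm,
        Finset.mul_sum]
      congr 1
      refine Finset.sum_congr rfl fun σ _ => ?_
      simp only [siteWeight_succ, Finset.prod_mul_distrib]
      rw [Equiv.prod_comp σ fun i => equalWeight a (p 0) (q 0) (u i)]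
      ring

/-! ### Symmetry and assembly of the double-row formula. -/

/-- The symmetric function of the wavefunction with homogeneous column parameters. -/
noncomputable def homF (a b : ℂ) {M N : ℕ} (p q : Fin M → ℂ) (z : Fin N → ℂ)
    (x : Fin N → Fin M) : ℂ :=
  (a ^ 2 - (a ^ 2)⁻¹) ^ N * (∏ j, (-(a ^ 2) * z j ^ 2 + (a ^ 2)⁻¹ * (z j ^ 2)⁻¹)) *
    ∑ σ : Equiv.Perm (Fin N), ∑ τ : Fin N → ℤˣ,
      let u : Fin N → ℂ := fun k => z (σ k) ^ (τ (σ k) : ℤ)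
      (∏ j, 1 / (z j ^ (2 * (τ j : ℤ)) - z j ^ (-2 * (τ j : ℤ)))) *
        pairFactor a u *
        (∏ k, (b * a⁻¹ * (u k)⁻¹ - b⁻¹ * a * u k)) *
        (∏ k, vacuumValue a p q (u k)⁻¹) *
        (∏ k, siteWeight a p q (x k) (u k))

/-- The substitution σ ↦ π⁻¹σ, τ ↦ τ ∘ π leaves u unchanged. -/
theorem homF_comp_perm (a b : ℂ) {M N : ℕ} (p q : Fin M → ℂ) (z : Fin N → ℂ)
    (x : Fin N → Fin M) (π : Equiv.Perm (Fin N)) :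
    homF a b p q (fun j => z (π j)) x = homF a b p q z x := by
  have hπ : ∀ k, π (π⁻¹ k) = k := π.apply_symm_apply
  unfold homF
  rw [Equiv.prod_comp π fun j => (-(a ^ 2) * z j ^ 2 + (a ^ 2)⁻¹ * (z j ^ 2)⁻¹)]
  congr 1
  rw [← Equiv.sum_comp (Equiv.mulLeft π⁻¹)]
  refine Finset.sum_congr rfl fun σ _ => ?_
  rw [← (Equiv.arrowCongr π.symm (Equiv.refl ℤˣ)).sum_comp]
  refine Finset.sum_congr rfl fun τ _ => ?_
  simp only [Equiv.arrowCongr_apply, Equiv.symm_symm, Equiv.coe_refl, Function.comp_apply, id_eq,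
    Equiv.coe_mulLeft, Equiv.Perm.mul_apply, hπ]
  rw [Equiv.prod_comp π fun j => 1 / (z j ^ (2 * (τ j : ℤ)) - z j ^ (-2 * (τ j : ℤ)))]

theorem pairFactor_eq (a : ℂ) {N : ℕ} (u : Fin N → ℂ) (hu : ∀ j, u j ≠ 0) :
    pairFactor a u = (∏ j, ∏ k ∈ Finset.Ioi j, exchF a (u j)⁻¹ (u k)) *
      ∏ j, ∏ k ∈ Finset.Ioi j, exchF a (u j) (u k) := by
  have key : ∀ s t : ℂ, s ≠ 0 → t ≠ 0 →
      (a ^ 2 * s⁻¹ * t - (a ^ 2)⁻¹ * s * t⁻¹) / (s⁻¹ * t - s * t⁻¹) = -exchF a s t := by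
    intro s t hs ht
    have hst : s * t ≠ 0 := mul_ne_zero hs ht
    unfold exchF
    rw [neg_neg, ← mul_div_mul_left _ _ hst]
    congr 1 <;> field_simp
  unfold pairFactor
  simp only [← Finset.prod_mul_distrib]
  refine Finset.prod_congr rfl fun j _ => Finset.prod_congr rfl fun k _ => ?_
  have h := key (u j)⁻¹ (u k) (inv_ne_zero (hu j)) (hu k)
  rw [inv_inv] at h
  rw [mul_div_mul_comm, h, key _ _ (hu j) (hu k), neg_mul_neg]

/-- The bulk coefficient does not change when its parameters are permuted, so it may be evaluated at
the σ-ordered u. There its factors `exchF` at (u_j⁻¹, u_k) complete those at (u_j, u_k) to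
`pairFactor`. -/
theorem bulkCoeff_mul_exchF (a b : ℂ) {M N : ℕ} (p q : Fin M → ℂ) (z : Fin N → ℂ)
    (hz : ∀ j, z j ≠ 0) (σ : Equiv.Perm (Fin N)) (τ : Fin N → ℤˣ) :
    bulkCoeff a b (vacuumValue a p q) (fun j => z j ^ (τ j : ℤ)) *
        (∏ j, ∏ k ∈ Finset.Ioi j,
          exchF a (z (σ j) ^ (τ (σ j) : ℤ)) (z (σ k) ^ (τ (σ k) : ℤ)))
      = (∏ j, 1 / (z j ^ (2 * (τ j : ℤ)) - z j ^ (-2 * (τ j : ℤ)))) *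
        pairFactor a (fun k => z (σ k) ^ (τ (σ k) : ℤ)) *
        (∏ k, (b * a⁻¹ * (z (σ k) ^ (τ (σ k) : ℤ))⁻¹ - b⁻¹ * a * z (σ k) ^ (τ (σ k) : ℤ))) *
        (∏ k, vacuumValue a p q (z (σ k) ^ (τ (σ k) : ℤ))⁻¹) := by
  have hu : ∀ j, z j ^ (τ j : ℤ) ≠ 0 := fun j => zpow_ne_zero _ (hz j)
  have hpair : pairProd Finset.univ
      (fun i j => exchF a (z (σ i) ^ (τ (σ i) : ℤ))⁻¹ (z (σ j) ^ (τ (σ j) : ℤ)))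
      = pairProd Finset.univ (fun i j => exchF a (z i ^ (τ i : ℤ))⁻¹ (z j ^ (τ j : ℤ))) := by
    rw [pairProd_comp (h := fun i j => exchF a (z i ^ (τ i : ℤ))⁻¹ (z j ^ (τ j : ℤ)))
      (fun i j => exchF_inv_symm a (hu i) (hu j)) Finset.univ σ.injective,
      Finset.image_univ_equiv]
  rw [pairFactor_eq a _ fun j => hu (σ j),
    prod_Ioi_eq_pairProd fun i j =>
      exchF a (z (σ i) ^ (τ (σ i) : ℤ))⁻¹ (z (σ j) ^ (τ (σ j) : ℤ)), hpair,
    Equiv.prod_comp σ fun k => (b * a⁻¹ * (z k ^ (τ k : ℤ))⁻¹ - b⁻¹ * a * z k ^ (τ k : ℤ)),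
    Equiv.prod_comp σ fun k => vacuumValue a p q (z k ^ (τ k : ℤ))⁻¹, bulkCoeff]
  have hden : ∀ j, boundaryCoeff a b (z j ^ (τ j : ℤ))
      = 1 / (z j ^ (2 * (τ j : ℤ)) - z j ^ (-2 * (τ j : ℤ))) *
        (b * a⁻¹ * (z j ^ (τ j : ℤ))⁻¹ - b⁻¹ * a * z j ^ (τ j : ℤ)) := by
    intro j
    have h1 : z j ^ (2 * (τ j : ℤ)) = (z j ^ (τ j : ℤ)) ^ 2 := by
      rw [mul_comm, zpow_mul]
      rfl
    have h2 : z j ^ (-2 * (τ j : ℤ)) = ((z j ^ (τ j : ℤ)) ^ 2)⁻¹ := by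
      rw [neg_mul, zpow_neg, h1]
    rw [h1, h2, boundaryCoeff]
    ring
  simp only [hden, Finset.prod_mul_distrib]
  ring

/-- The wavefunction with homogeneous column parameters. -/
theorem doubleRowOp_prod_vacuum_apply {a b : ℂ} (ha : a ≠ 0) (hb : b ≠ 0) {M N : ℕ}
    (p q : Fin M → ℂ) (z : Fin N → ℂ) (hz : ∀ j, z j ≠ 0) (hz4 : ∀ j, z j ^ 4 ≠ 1)
    (hzz : ∀ j k, j ≠ k → z j ^ 2 ≠ z k ^ 2 ∧ z j ^ 2 * z k ^ 2 ≠ 1)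
    (x : Fin N → Fin M) (hx : StrictMono x) :
    (List.ofFn fun j => doubleRowOp a b (rowOp a p q 0) (rowOp a p q 1) (z j)).prod
      (vacuum M) (particles x) = homF a b p q z x := by
  obtain ⟨R, _, _, _, β, hB⟩ := exists_B_action ha p q
  rw [doubleRowOp_prod_vacuum ha hb hB (B_action_exchange ha p q hB)
    (fun u _ => rowOp_D_vacuum a p q u) z hz hz4 hzz, Pi.smul_apply, Finset.sum_apply,
    smul_eq_mul, homF, mul_comm ((a ^ 2 - (a ^ 2)⁻¹) ^ N), mul_assoc, Finset.sum_comm]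
  congr 1
  rw [Finset.mul_sum]
  refine Finset.sum_congr rfl fun τ _ => ?_
  rw [Pi.smul_apply, smul_eq_mul, prod_B_vacuum_apply ha p q hB (fun j => z j ^ (τ j : ℤ))
    (fun j => zpow_ne_zero _ (hz j))
    (fun i j hij => zpow_units_sq_ne (hz j) (hzz i j hij).1 (hzz i j hij).2 _ _) x hx,
    mul_left_comm, Finset.mul_sum]
  congr 1
  refine Finset.sum_congr rfl fun σ _ => ?_
  rw [← mul_assoc, bulkCoeff_mul_exchF a b p q z hz σ τ]

/-- The matrix of the double-row `B`-operator with homogeneous column parameters. -/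
noncomputable def homDoubleRow (a b : ℂ) {M : ℕ} (p q : Fin M → ℂ) (z : ℂ) :
    Matrix (Config M) (Config M) ℂ :=
  kCovector a b z (0, 1) • (rowMatrix a p q z⁻¹ 0 * rowMatrix a p q z 1)
    + kCovector a b z (1, 0) • (rowMatrix a p q z⁻¹ 1 * rowMatrix a p q z 0)

theorem homDoubleRow_mulVecLin (a b : ℂ) {M : ℕ} (p q : Fin M → ℂ) (z : ℂ) :
    (homDoubleRow a b p q z).mulVecLin
      = doubleRowOp a b (rowOp a p q 0) (rowOp a p q 1) z := by
  refine LinearMap.ext fun φ => ?_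
  simp [homDoubleRow, doubleRowOp, rowOp, Matrix.mulVec_mulVec]

theorem homDoubleRow_prod_apply {a b : ℂ} (ha : a ≠ 0) (hb : b ≠ 0) {M N : ℕ}
    (p q : Fin M → ℂ) (z : Fin N → ℂ) (hz : ∀ j, z j ≠ 0) (hz4 : ∀ j, z j ^ 4 ≠ 1)
    (hzz : ∀ j k, j ≠ k → z j ^ 2 ≠ z k ^ 2 ∧ z j ^ 2 * z k ^ 2 ≠ 1)
    (x : Fin N → Fin M) (hx : StrictMono x) :
    (List.ofFn fun j => homDoubleRow a b p q (z j)).prod (particles x) (fun _ => 0)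
      = homF a b p q z x := by
  have h : ∀ {N : ℕ} (z : Fin N → ℂ) (φ : Config M → ℂ),
      (List.ofFn fun j => homDoubleRow a b p q (z j)).prod.mulVec φ
        = (List.ofFn fun j =>
            doubleRowOp a b (rowOp a p q 0) (rowOp a p q 1) (z j)).prod φ := by
    intro N z φ
    induction N with
    | zero => simp
    | succ N ih =>
      rw [List.ofFn_succ, List.ofFn_succ, List.prod_cons, List.prod_cons,
        ← Matrix.mulVec_mulVec, ih fun j => z j.succ, Module.End.mul_apply,
        ← homDoubleRow_mulVecLin, Matrix.mulVecLin_apply]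
  rw [← doubleRowOp_prod_vacuum_apply ha hb p q z hz hz4 hzz x hx, ← h, vacuum,
    Matrix.mulVec_single_one]
  rfl

/-! ### Identification with the operators of the model. -/

theorem homWeight_one (a w z : ℂ) : homWeight a 1 w z = lMatrix a z w := by
  ext ⟨i, j⟩ ⟨k, l⟩
  fin_cases i <;> fin_cases j <;> fin_cases k <;> fin_cases l <;>
    simp [homWeight, lMatrix, equalWeight, distinctWeight]

/-- An operator on the sites other than the first, extended by the identity. -/
def extendFirst {M : ℕ} (T : Matrix (Fin 2 × Config M) (Fin 2 × Config M) ℂ) :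
    Matrix (Fin 2 × Config (M + 1)) (Fin 2 × Config (M + 1)) ℂ :=
  fun out inp => if out.2 0 = inp.2 0 then
    T (out.1, Fin.tail out.2) (inp.1, Fin.tail inp.2) else 0

theorem sum_config_succ {M : ℕ} (h : Config (M + 1) → ℂ) :
    ∑ y, h y = ∑ i : Fin 2, ∑ y : Config M, h (Fin.cons i y : Config (M + 1)) := by
  rw [← (Fin.consEquiv fun _ : Fin (M + 1) => Fin 2).sum_comp, Fintype.sum_prod_type]
  rfl

theorem extendFirst_one (M : ℕ) :
    extendFirst (1 : Matrix (Fin 2 × Config M) (Fin 2 × Config M) ℂ) = 1 := by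
  ext ⟨γ, y⟩ ⟨α, x⟩
  have h : y = x ↔ y 0 = x 0 ∧ Fin.tail y = Fin.tail x := by
    constructor
    · rintro rfl
      exact ⟨rfl, rfl⟩
    · rintro ⟨h0, ht⟩
      rw [← Fin.cons_self_tail y, ← Fin.cons_self_tail x, h0, ht]
  simp only [extendFirst, Matrix.one_apply, Prod.mk.injEq, h]
  split_ifs <;> simp_all

theorem extendFirst_mul {M : ℕ} (S T : Matrix (Fin 2 × Config M) (Fin 2 × Config M) ℂ) :
    extendFirst (S * T) = extendFirst S * extendFirst T := by
  ext ⟨γ, y⟩ ⟨α, x⟩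
  simp only [extendFirst, Matrix.mul_apply, Fintype.sum_prod_type, sum_config_succ,
    Fin.cons_zero, Fin.tail_cons, ite_mul, zero_mul, mul_ite, mul_zero]
  split_ifs with h
  · refine Finset.sum_congr rfl fun β _ => ?_
    rw [Finset.sum_eq_single (y 0)]
    · simp [h]
    · intro i _ hi
      simp [hi.symm]
    · simp
  · symm
    refine Finset.sum_eq_zero fun β _ => Finset.sum_eq_zero fun i _ =>
      Finset.sum_eq_zero fun t _ => ?_
    split_ifs with h1 h2
    · exact absurd (h2.trans h1) h
    · rfl
    · rfl

theorem extendFirst_lOperator (a z w : ℂ) {M : ℕ} (j : Fin M) :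
    extendFirst (lOperator a z w j) = lOperator a z w j.succ := by
  ext ⟨γ, y⟩ ⟨α, x⟩
  have h : (∀ k, k ≠ j.succ → y k = x k) ↔
      y 0 = x 0 ∧ ∀ k, k ≠ j → Fin.tail y k = Fin.tail x k := by
    rw [Fin.forall_fin_succ]
    simp [Fin.tail, (Fin.succ_ne_zero j).symm]
  by_cases h0 : y 0 = x 0
  · simp only [extendFirst, lOperator, h, h0, true_and, if_true]
    rfl
  · simp [extendFirst, lOperator, h, h0]

theorem extendFirst_list_prod {M : ℕ}
    (l : List (Matrix (Fin 2 × Config M) (Fin 2 × Config M) ℂ)) :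
    extendFirst l.prod = (l.map extendFirst).prod := by
  induction l with
  | nil => simp [extendFirst_one]
  | cons T l ih => simp [extendFirst_mul, ih]

theorem monodromy_succ (a z : ℂ) {M : ℕ} (w : Fin (M + 1) → ℂ) :
    monodromy a z w = lOperator a z (w 0) 0 * extendFirst (monodromy a z (Fin.tail w)) := by
  rw [monodromy, monodromy, extendFirst_list_prod, List.ofFn_succ, List.prod_cons, List.map_ofFn]
  simp only [Function.comp_def, extendFirst_lOperator]
  rfl

theorem monodromy_eq_rowMatrix (a z : ℂ) {M : ℕ} (w : Fin M → ℂ) (γ : Fin 2)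
    (y x : Config M) :
    monodromy a z w (γ, y) (1, x) = rowMatrix a (fun _ => 1) w z γ y x := by
  induction M generalizing γ with
  | zero => simp [monodromy, rowMatrix, Matrix.one_apply, Subsingleton.elim y x]
  | succ M ih =>
    have h : ∀ i (t : Config M), (∀ k : Fin (M + 1), k ≠ 0 →
        y k = (Fin.cons i t : Config (M + 1)) k) ↔ Fin.tail y = t := by
      intro i t
      rw [Fin.forall_fin_succ, funext_iff]
      simp [Fin.tail]
    rw [monodromy_succ, Matrix.mul_apply, Fintype.sum_prod_type, rowMatrix]
    refine Finset.sum_congr rfl fun β _ => ?_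
    -- The intermediate configuration is forced: the later factors fix the first site and the first
    -- factor fixes all others.
    rw [sum_config_succ, Finset.sum_eq_single (x 0), Finset.sum_eq_single (Fin.tail y)]
    · simp only [lOperator, extendFirst, h, Fin.cons_zero, Fin.tail_cons, if_true, ih,
        homWeight_one]
      rfl
    · intro t _ ht
      simp [lOperator, h, ht.symm]
    · simp
    · intro i _ hi
      exact Finset.sum_eq_zero fun t _ => by simp [extendFirst, hi]
    · simp

theorem doubleRowB_eq (a b z : ℂ) {M : ℕ} (w : Fin M → ℂ) :
    doubleRowB a b z w = homDoubleRow a b (fun _ => 1) w z := by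
  ext y x
  simp only [doubleRowB, doubleRowMonodromy, homDoubleRow, Matrix.mul_apply, kOperator,
    onSecondAux, onFirstAux, Fintype.sum_prod_type, Fin.sum_univ_two, ite_mul, zero_mul,
    Finset.sum_ite_eq, Finset.mem_univ, if_true, mul_ite, mul_zero, Matrix.add_apply,
    Matrix.smul_apply, smul_eq_mul, monodromy_eq_rowMatrix]
  simp [kCovector, Finset.mul_sum, mul_assoc, add_comm]

/-! ### Transposition and the dual wavefunction. -/

/-- Flipping the site label interchanges equal and distinct vertices, and the two weights are
interchanged by (p, q, z) ↦ (q, p, z⁻¹). The transposition acts on the site only, which keeps the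
auxiliary direction and the entries ⟨γ|T|1⟩. -/
theorem homWeight_transpose (a w z : ℂ) (γ β i j : Fin 2) :
    homWeight a 1 w z (γ, i) (β, j) = homWeight a w 1 z⁻¹ (γ, j.rev) (β, i.rev) := by
  fin_cases γ <;> fin_cases i <;> fin_cases β <;> fin_cases j <;>
    simp [homWeight, equalWeight, distinctWeight]

/-- Exchanging the labels `0` and `1` at all sites. -/
def flipConfig (M : ℕ) : Config M ≃ Config M := Equiv.arrowCongr (Equiv.refl _) Fin.revPerm

theorem rowMatrix_transpose (a : ℂ) {M : ℕ} (w : Fin M → ℂ) (z : ℂ) (γ : Fin 2)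
    (y x : Config M) :
    rowMatrix a (fun _ => 1) w z γ y x
      = rowMatrix a w (fun _ => 1) z⁻¹ γ (flipConfig M x) (flipConfig M y) := by
  induction M generalizing γ with
  | zero => rfl
  | succ M ih =>
    rw [rowMatrix, rowMatrix]
    refine Finset.sum_congr rfl fun β _ => ?_
    rw [homWeight_transpose]
    congr 1
    exact ih _ _ _ _

theorem kCovector_neg_inv (a b z : ℂ) :
    kCovector a (-b⁻¹) z (0, 1) = kCovector a b z (1, 0) ∧
      kCovector a (-b⁻¹) z (1, 0) = kCovector a b z (0, 1) := by
  constructor <;> simp only [kCovector, inv_neg, inv_inv] <;> ring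

theorem homDoubleRow_transpose (a b : ℂ) {M : ℕ} (w : Fin M → ℂ) (z : ℂ) :
    homDoubleRow a b (fun _ => 1) w z =
      (homDoubleRow a (-b⁻¹) w (fun _ => 1) z).transpose.submatrix
        (flipConfig M) (flipConfig M) := by
  have h : ∀ z γ, rowMatrix a (fun _ => 1) w z γ
      = (rowMatrix a w (fun _ => 1) z⁻¹ γ).transpose.submatrix
        (flipConfig M) (flipConfig M) := by
    intro z γ
    ext y x
    exact rowMatrix_transpose a w z γ y x
  rw [homDoubleRow, homDoubleRow, (kCovector_neg_inv a b z).1, (kCovector_neg_inv a b z).2, h, h,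
    h, h, Matrix.submatrix_mul_equiv, Matrix.submatrix_mul_equiv, inv_inv,
    ← Matrix.transpose_mul, ← Matrix.transpose_mul, add_comm]
  rfl

theorem list_prod_transpose_submatrix {n : Type*} [Fintype n] [DecidableEq n] (e : n ≃ n)
    (l : List (Matrix n n ℂ)) :
    (l.map fun A => A.transpose.submatrix e e).prod
      = l.reverse.prod.transpose.submatrix e e := by
  induction l with
  | nil => simp
  | cons A l ih =>
    rw [List.map_cons, List.prod_cons, ih, Matrix.submatrix_mul_equiv, ← Matrix.transpose_mul]
    simp

theorem reverse_ofFn {A : Type*} {N : ℕ} (f : Fin N → A) :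
    (List.ofFn f).reverse = List.ofFn fun j => f (Fin.revPerm j) := by
  refine List.ext_getElem (by simp) fun i _ _ => ?_
  rw [List.getElem_reverse, List.getElem_ofFn, List.getElem_ofFn]
  congr 1
  ext
  simp only [List.length_ofFn, Fin.revPerm_apply, Fin.val_rev]
  omega

theorem wavefunction_eq_homF {a b : ℂ} (ha : a ≠ 0) (hb : b ≠ 0) {M N : ℕ}
    (z : Fin N → ℂ) (w : Fin M → ℂ) (hz : ∀ j, z j ≠ 0) (hz4 : ∀ j, z j ^ 4 ≠ 1)
    (hzz : ∀ j k, j ≠ k → z j ^ 2 ≠ z k ^ 2 ∧ z j ^ 2 * z k ^ 2 ≠ 1)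
    (x : Fin N → Fin M) (hx : StrictMono x) :
    wavefunction a b z w x = homF a b (fun _ => 1) w z x := by
  rw [← homDoubleRow_prod_apply ha hb _ w z hz hz4 hzz x hx, wavefunction]
  simp only [doubleRowB_eq]

theorem dualWavefunction_eq_homF {a b : ℂ} (ha : a ≠ 0) (hb : b ≠ 0) {M N : ℕ}
    (z : Fin N → ℂ) (w : Fin M → ℂ) (hz : ∀ j, z j ≠ 0) (hz4 : ∀ j, z j ^ 4 ≠ 1)
    (hzz : ∀ j k, j ≠ k → z j ^ 2 ≠ z k ^ 2 ∧ z j ^ 2 * z k ^ 2 ≠ 1)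
    (x : Fin N → Fin M) (hx : StrictMono x) :
    dualWavefunction a b z w x = homF a (-b⁻¹) w (fun _ => 1) z x := by
  have hflip : flipConfig M (holes x) = particles x := by
    funext j
    simp only [flipConfig, Equiv.arrowCongr_apply, Function.comp_apply, holes, particles]
    split_ifs <;> simp_all
  have hflip1 : flipConfig M (fun _ => 1) = fun _ => 0 := rfl
  have hrev := homDoubleRow_prod_apply ha (neg_ne_zero.2 (inv_ne_zero hb)) w (fun _ => 1)
    (fun j => z (Fin.revPerm j)) (fun j => hz _) (fun j => hz4 _)
    (fun j k hjk => hzz _ _ (Fin.revPerm.injective.ne hjk)) x hx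
  -- Transposition reverses the order of the z's; the symmetry of `homF` undoes this.
  rw [homF_comp_perm] at hrev
  rw [← hrev, dualWavefunction]
  simp only [doubleRowB_eq, homDoubleRow_transpose]
  rw [← Function.comp_def (fun A : Matrix (Config M) (Config M) ℂ =>
      A.transpose.submatrix (flipConfig M) (flipConfig M)), ← List.map_ofFn,
    list_prod_transpose_submatrix, Matrix.submatrix_apply, Matrix.transpose_apply, hflip, hflip1]
  rw [reverse_ofFn]

theorem symF_eq_homF (a b : ℂ) {M N : ℕ} (z : Fin N → ℂ) (w : Fin M → ℂ) (x : Fin N → Fin M) :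
    symF a b z w x = homF a b (fun _ => 1) w z x := by
  simp only [symF, homF, vacuumValue, siteWeight, equalWeight, distinctWeight, inv_inv, mul_one,
    Finset.prod_mul_distrib, mul_assoc]

theorem dualSymF_eq_homF (a b : ℂ) {M N : ℕ} (z : Fin N → ℂ) (w : Fin M → ℂ)
    (x : Fin N → Fin M) :
    dualSymF a b z w x = homF a (-b⁻¹) w (fun _ => 1) z x := by
  have h : ∀ u : ℂ, b * a * u - b⁻¹ * a⁻¹ * u⁻¹ = -b⁻¹ * a⁻¹ * u⁻¹ - (-b⁻¹)⁻¹ * a * u := by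
    intro u
    rw [inv_neg, inv_inv]
    ring
  simp only [dualSymF, homF, vacuumValue, siteWeight, equalWeight, distinctWeight, inv_inv,
    mul_one, Finset.prod_mul_distrib, h]
  simp only [mul_assoc]

end SixVertexReflecting

theorem mainTheorem1 (M N : ℕ) (a b : ℂ) (ha : a ≠ 0) (hb : b ≠ 0)
    (z : Fin N → ℂ) (w : Fin M → ℂ)
    (hz : ∀ j, z j ≠ 0) (hz4 : ∀ j, z j ^ 4 ≠ 1)
    (hzz : ∀ j k, j ≠ k → z j ^ 2 ≠ z k ^ 2 ∧ z j ^ 2 * z k ^ 2 ≠ 1) :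
    (∀ x : Fin N → Fin M, StrictMono x →
      SixVertexReflecting.wavefunction a b z w x = SixVertexReflecting.symF a b z w x ∧
      ∀ π : Equiv.Perm (Fin N),
        SixVertexReflecting.symF a b (fun j => z (π j)) w x =
          SixVertexReflecting.symF a b z w x) ∧
    (∀ x' : Fin N → Fin M, StrictMono x' →
      SixVertexReflecting.dualWavefunction a b z w x' =
        SixVertexReflecting.dualSymF a b z w x' ∧
      ∀ π : Equiv.Perm (Fin N),
        SixVertexReflecting.dualSymF a b (fun j => z (π j)) w x' =
          SixVertexReflecting.dualSymF a b z w x') := by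
  refine ⟨fun x hx => ⟨?_, fun π => ?_⟩, fun x hx => ⟨?_, fun π => ?_⟩⟩
  · rw [SixVertexReflecting.symF_eq_homF]
    exact SixVertexReflecting.wavefunction_eq_homF ha hb z w hz hz4 hzz x hx
  · rw [SixVertexReflecting.symF_eq_homF, SixVertexReflecting.symF_eq_homF]
    exact SixVertexReflecting.homF_comp_perm a b _ w z x π
  · rw [SixVertexReflecting.dualSymF_eq_homF]
    exact SixVertexReflecting.dualWavefunction_eq_homF ha hb z w hz hz4 hzz x hx
  · rw [SixVertexReflecting.dualSymF_eq_homF, SixVertexReflecting.dualSymF_eq_homF]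
    exact SixVertexReflecting.homF_comp_perm a _ w _ z x π
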